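/- Let $X,Y\subset\mathbb{R}$ be sets of $n\ge 1$ real numbers each; the Cartesian product $X\times Y$ is called an $n\times n$ grid. A polygon is convex if all of its internal angles are strictly smaller than $\pi$. (Single points and segments count as degenerate convex polygons with one and two vertices.) The grid supports a polygon $P$ if all vertices of $P$ lie in $X\times Y$ and no two vertices of $P$ share an $x$- or a $y$-coordinate. A convex polygon with vertices $(x_1,y_1),\dots,(x_k,y_k)$, listed in clockwise order from some starting vertex, is a convex cap if at least one of the following holds: $(x_i)_{i=1}^k$ strictly increases, $(y_i)_{i=1}^k$ strictly increases, $(x_i)_{i=1}^k$ strictly decreases, or $(y_i)_{i=1}^k$ strictly decreases; these conditions define the four types of convex caps. The size of a cap is its number of vertices. The model of computation is the unit-cost real RAM: exact real numbers with field operations and comparisons, and integers of $O(\log n)$ bits, which also serve as memory addresses; space is the number of memory cells. The input consists of $n$ and the elements of $X$ and of $Y$, in arbitrary order. **Lemma.** For a given $n\times n$ grid, a supported convex cap of maximum size can be computed in $O(n^{10})$ time and $O(n^8)$ space. Moreover, for each of the four types, a supported convex cap of that type of maximum size can be computed within the same bounds. -/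

import Mathlib

/-! ## Convex polygons, caps, and grids -/

/-- Twice the signed area of the triangle `p q r`; it is negative exactly when the triangle is
traversed clockwise, and zero exactly when the three points are collinear. -/
def orient (p q r : ℝ × ℝ) : ℝ :=
  (q.1 - p.1) * (r.2 - p.2) - (q.2 - p.2) * (r.1 - p.1)

/-- `P` lists, in clockwise order from some starting vertex, the vertices of a convex polygon whose
internal angles are all strictly smaller than `π`: any three vertices, taken in the order of the
list, form a clockwise, nondegenerate triangle. Single points and segments count as (degenerate)
polygons with one and two vertices. -/
def IsConvexPolygon (P : List (ℝ × ℝ)) : Prop :=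
  ∀ i j k : Fin P.length, i < j → j < k → orient (P.get i) (P.get j) (P.get k) < 0

/-- The four types of convex caps. -/
inductive CapType where
  /-- The `x`-coordinates increase in clockwise order. -/
  | top
  /-- The `y`-coordinates increase in clockwise order. -/
  | left
  /-- The `x`-coordinates decrease in clockwise order. -/
  | bottom
  /-- The `y`-coordinates decrease in clockwise order. -/
  | right

/-- The monotonicity condition that defines each type of convex cap. -/
def CapType.Monotonic : CapType → List (ℝ × ℝ) → Prop
  | .top, P => (P.map Prod.fst).Pairwise (· < ·)
  | .left, P => (P.map Prod.snd).Pairwise (· < ·)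
  | .bottom, P => (P.map Prod.fst).Pairwise (· > ·)
  | .right, P => (P.map Prod.snd).Pairwise (· > ·)

/-- `P` is a convex cap of type `τ`. -/
def IsConvexCapOfType (τ : CapType) (P : List (ℝ × ℝ)) : Prop :=
  IsConvexPolygon P ∧ τ.Monotonic P

/-- `P` is a convex cap: a convex polygon whose `x`- or `y`-coordinates are monotonic. -/
def IsConvexCap (P : List (ℝ × ℝ)) : Prop :=
  ∃ τ : CapType, IsConvexCapOfType τ P

/-- The grid `X × Y` supports `P`: all vertices lie in `X × Y`, and no two of them share an `x`- or
a `y`-coordinate. -/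
def Supports (X Y : Set ℝ) (P : List (ℝ × ℝ)) : Prop :=
  (∀ p ∈ P, p ∈ X ×ˢ Y) ∧ (P.map Prod.fst).Nodup ∧ (P.map Prod.snd).Nodup

/-- `P` has the property `K`, is supported by the grid `X × Y`, and has the maximum number of
vertices among all such polygons. -/
def IsMaxSupported (K : List (ℝ × ℝ) → Prop) (X Y : Set ℝ) (P : List (ℝ × ℝ)) : Prop :=
  Supports X Y P ∧ K P ∧ ∀ Q, Supports X Y Q → K Q → Q.length ≤ P.length

/-! ## A real RAM

The machine has integer registers, real registers, integer arrays and real arrays. A program is a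
finite piece of structured code and so refers to finitely many registers and arrays, each by a
fixed number; the cells of an array are addressed by computed integers. Every elementary operation
costs one unit of time. Reals are exact and can only be copied, combined by field operations and
compared; in particular there is no rounding and no conversion of a real to an integer.

The resources are parameters of the semantics: `S` is the number of cells of each array and `W`
bounds the integers that the machine can handle (so integers have about `log W` bits).
An execution that addresses a cell outside an array, that produces an integer larger than `W`, or
that divides by zero, does not exist. -/

namespace RealRAM

/-- The memory of the machine: registers `ireg v`, `rreg v`, and array cells `imem a i`,
`rmem a i`. -/
structure State where
  ireg : ℕ → ℕ
  rreg : ℕ → ℝ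
  imem : ℕ → ℕ → ℕ
  rmem : ℕ → ℕ → ℝ

/-- Integer expressions; `sub` is truncated subtraction. -/
inductive IExpr where
  | const (c : ℕ)
  | reg (v : ℕ)
  | load (a : ℕ) (i : IExpr)
  | add (e f : IExpr)
  | sub (e f : IExpr)
  | mul (e f : IExpr)

/-- The value of an integer expression. -/
def IExpr.val (σ : State) : IExpr → ℕ
  | .const c => c
  | .reg v => σ.ireg v
  | .load a i => σ.imem a (i.val σ)
  | .add e f => e.val σ + f.val σ
  | .sub e f => e.val σ - f.val σ
  | .mul e f => e.val σ * f.val σ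

/-- The expression can be evaluated with `S` cells per array and integers up to `W`. -/
def IExpr.Ok (S W : ℕ) (σ : State) : IExpr → Prop
  | .const c => c ≤ W
  | .reg v => σ.ireg v ≤ W
  | .load a i => i.Ok S W σ ∧ i.val σ < S ∧ σ.imem a (i.val σ) ≤ W
  | .add e f => e.Ok S W σ ∧ f.Ok S W σ ∧ e.val σ + f.val σ ≤ W
  | .sub e f => e.Ok S W σ ∧ f.Ok S W σ
  | .mul e f => e.Ok S W σ ∧ f.Ok S W σ ∧ e.val σ * f.val σ ≤ W

/-- The number of operations in the evaluation of an integer expression. -/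
def IExpr.cost : IExpr → ℕ
  | .const _ => 1
  | .reg _ => 1
  | .load _ i => i.cost + 1
  | .add e f => e.cost + f.cost + 1
  | .sub e f => e.cost + f.cost + 1
  | .mul e f => e.cost + f.cost + 1

/-- Real expressions; the only constants are integers. -/
inductive RExpr where
  | const (c : ℤ)
  | reg (v : ℕ)
  | load (a : ℕ) (i : IExpr)
  | add (e f : RExpr)
  | sub (e f : RExpr)
  | mul (e f : RExpr)
  | div (e f : RExpr)

/-- The value of a real expression. -/
noncomputable def RExpr.val (σ : State) : RExpr → ℝ
  | .const c => (c : ℝ)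
  | .reg v => σ.rreg v
  | .load a i => σ.rmem a (i.val σ)
  | .add e f => e.val σ + f.val σ
  | .sub e f => e.val σ - f.val σ
  | .mul e f => e.val σ * f.val σ
  | .div e f => e.val σ / f.val σ

/-- The expression can be evaluated with `S` cells per array and integers up to `W`. -/
def RExpr.Ok (S W : ℕ) (σ : State) : RExpr → Prop
  | .const _ => True
  | .reg _ => True
  | .load _ i => i.Ok S W σ ∧ i.val σ < S
  | .add e f => e.Ok S W σ ∧ f.Ok S W σ
  | .sub e f => e.Ok S W σ ∧ f.Ok S W σ
  | .mul e f => e.Ok S W σ ∧ f.Ok S W σ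
  | .div e f => e.Ok S W σ ∧ f.Ok S W σ ∧ f.val σ ≠ 0

/-- The number of operations in the evaluation of a real expression. -/
def RExpr.cost : RExpr → ℕ
  | .const _ => 1
  | .reg _ => 1
  | .load _ i => i.cost + 1
  | .add e f => e.cost + f.cost + 1
  | .sub e f => e.cost + f.cost + 1
  | .mul e f => e.cost + f.cost + 1
  | .div e f => e.cost + f.cost + 1

/-- Tests. -/
inductive Test where
  | ltI (e f : IExpr)
  | eqI (e f : IExpr)
  | ltR (e f : RExpr)
  | not (b : Test)
  | and (b c : Test)

/-- The test succeeds. -/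
def Test.Holds (σ : State) : Test → Prop
  | .ltI e f => e.val σ < f.val σ
  | .eqI e f => e.val σ = f.val σ
  | .ltR e f => e.val σ < f.val σ
  | .not b => ¬ b.Holds σ
  | .and b c => b.Holds σ ∧ c.Holds σ

/-- The test can be evaluated with `S` cells per array and integers up to `W`. -/
def Test.Ok (S W : ℕ) (σ : State) : Test → Prop
  | .ltI e f => e.Ok S W σ ∧ f.Ok S W σ
  | .eqI e f => e.Ok S W σ ∧ f.Ok S W σ
  | .ltR e f => e.Ok S W σ ∧ f.Ok S W σ
  | .not b => b.Ok S W σ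
  | .and b c => b.Ok S W σ ∧ c.Ok S W σ

/-- The number of operations in the evaluation of a test. -/
def Test.cost : Test → ℕ
  | .ltI e f => e.cost + f.cost + 1
  | .eqI e f => e.cost + f.cost + 1
  | .ltR e f => e.cost + f.cost + 1
  | .not b => b.cost + 1
  | .and b c => b.cost + c.cost + 1

/-- Programs: assignments to registers, assignments to array cells, sequential composition, case
distinctions and while loops. -/
inductive Program where
  | skip
  | setI (v : ℕ) (e : IExpr)
  | setR (v : ℕ) (e : RExpr)
  | storeI (a : ℕ) (i : IExpr) (e : IExpr)
  | storeR (a : ℕ) (i : IExpr) (e : RExpr)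
  | seq (p q : Program)
  | cond (b : Test) (p q : Program)
  | loop (b : Test) (p : Program)

/-- `Exec S W p σ σ' t`: with `S` cells per array and integers up to `W`, the program `p`, started
in the state `σ`, halts in the state `σ'` after `t` units of time. -/
inductive Exec (S W : ℕ) : Program → State → State → ℕ → Prop where
  | skip (σ : State) : Exec S W .skip σ σ 1
  | setI (σ : State) (v : ℕ) (e : IExpr) (he : e.Ok S W σ) :
      Exec S W (.setI v e) σ { σ with ireg := Function.update σ.ireg v (e.val σ) } (e.cost + 1)
  | setR (σ : State) (v : ℕ) (e : RExpr) (he : e.Ok S W σ) :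
      Exec S W (.setR v e) σ { σ with rreg := Function.update σ.rreg v (e.val σ) } (e.cost + 1)
  | storeI (σ : State) (a : ℕ) (i e : IExpr) (hi : i.Ok S W σ) (hS : i.val σ < S)
      (he : e.Ok S W σ) :
      Exec S W (.storeI a i e) σ
        { σ with imem := Function.update σ.imem a (Function.update (σ.imem a) (i.val σ) (e.val σ)) }
        (i.cost + e.cost + 1)
  | storeR (σ : State) (a : ℕ) (i : IExpr) (e : RExpr) (hi : i.Ok S W σ) (hS : i.val σ < S)
      (he : e.Ok S W σ) :
      Exec S W (.storeR a i e) σ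
        { σ with rmem := Function.update σ.rmem a (Function.update (σ.rmem a) (i.val σ) (e.val σ)) }
        (i.cost + e.cost + 1)
  | seq {p q : Program} {σ₁ σ₂ σ₃ : State} {t u : ℕ} (hp : Exec S W p σ₁ σ₂ t)
      (hq : Exec S W q σ₂ σ₃ u) : Exec S W (.seq p q) σ₁ σ₃ (t + u)
  | cond_true {b : Test} {p q : Program} {σ₁ σ₂ : State} {t : ℕ} (hok : b.Ok S W σ₁)
      (hb : b.Holds σ₁) (hp : Exec S W p σ₁ σ₂ t) :
      Exec S W (.cond b p q) σ₁ σ₂ (b.cost + 1 + t)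
  | cond_false {b : Test} {p q : Program} {σ₁ σ₂ : State} {t : ℕ} (hok : b.Ok S W σ₁)
      (hb : ¬ b.Holds σ₁) (hq : Exec S W q σ₁ σ₂ t) :
      Exec S W (.cond b p q) σ₁ σ₂ (b.cost + 1 + t)
  | loop_true {b : Test} {p : Program} {σ₁ σ₂ σ₃ : State} {t u : ℕ} (hok : b.Ok S W σ₁)
      (hb : b.Holds σ₁) (hp : Exec S W p σ₁ σ₂ t) (hl : Exec S W (.loop b p) σ₂ σ₃ u) :
      Exec S W (.loop b p) σ₁ σ₃ (b.cost + 1 + t + u)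
  | loop_false {b : Test} {p : Program} {σ : State} (hok : b.Ok S W σ) (hb : ¬ b.Holds σ) :
      Exec S W (.loop b p) σ σ (b.cost + 1)

/-- The initial state for the `n × n` grid with coordinates `x` and `y`: integer register `0` holds
`n`, the real arrays `0` and `1` hold `x` and `y`, and everything else is zero. -/
noncomputable def input (n : ℕ) (x y : Fin n → ℝ) : State where
  ireg v := if v = 0 then n else 0
  rreg _ := 0
  imem _ _ := 0
  rmem a i := if h : i < n then
      (if a = 0 then x ⟨i, h⟩ else if a = 1 then y ⟨i, h⟩ else 0)
    else 0

/-- The list of points that a final state represents: its length is in integer register `0`, and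
the `x`- and `y`-coordinates are in the real arrays `2` and `3`. -/
def output (σ : State) : List (ℝ × ℝ) :=
  (List.range (σ.ireg 0)).map fun i => (σ.rmem 2 i, σ.rmem 3 i)

end RealRAM

/-- A maximum-size supported polygon with the property `K` can be computed in `O(T n)` time and
`O(S n)` space on `n × n` grids: there is one program that, for every `n ≥ 1` and every `n × n` grid
(whose coordinates are given in arbitrary order), halts within `C * T n` steps on a machine
with `C * S n` cells per array and with integers of `O(log n)` bits, and outputs such a polygon. -/
def MaxSupportedComputable (K : List (ℝ × ℝ) → Prop) (T S : ℕ → ℕ) : Prop :=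
  ∃ (p : RealRAM.Program) (C d : ℕ), ∀ n : ℕ, 1 ≤ n → ∀ x y : Fin n → ℝ,
    Function.Injective x → Function.Injective y →
      ∃ (σ : RealRAM.State) (t : ℕ),
        RealRAM.Exec (C * S n) (C * n ^ d) p (RealRAM.input n x y) σ t ∧
        t ≤ C * T n ∧
        IsMaxSupported K (Set.range x) (Set.range y) (RealRAM.output σ)

/-! Rotations by multiples of a right angle turn caps of every type into top caps, so it suffices to
treat top caps on the `N = n * n` grid points. The distinct ordinates of a supported cap make one
end strictly lower than the other, and by convexity the lower end is the lowest vertex of the cap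
(`IsCapList.lt_of_head_lt`). Removing the lower end again and again shows that every cap grows from
its highest vertex by adding vertices to the left or to the right in decreasing order of ordinates
(`IsCapList.exists_reach`).

Conversely, a new vertex has to be tested only against the end edge that it extends: along an
`x`-monotone chain, clockwise turns at consecutive vertices imply clockwise turns everywhere
(`orient_chain`), so local tests produce only caps (`Reach.invariant`). All that matters about a
partial cap is therefore its two end edges `a b` and `d c`, which gives `N ^ 4 = n ^ 8` table
entries. In a given entry the lower of `a` and `c` was added last. Deleting it exposes a known
vertex as the new end, and only the far vertex `e` of the new end edge is unknown, so a maximum over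
`N` candidates computes the entry (`compute_spec`). This gives time `N ^ 5 = n ^ 10`.

The points are indexed in decreasing order of ordinates, and the entries are filled in lexicographic
order of `(a, c, b, d)`. Both kinds of predecessor replace `a` or `c` by a smaller index, so they
are already present (`code_lt_left`, `code_lt_right`). Stored parents allow a cap to be written out
in time linear in its size (`backtrack_spec`). That size is at most `n`, so rewriting the output at
every improvement costs no more than the search that precedes it. -/

namespace RealRAM

/-! ### Program logic with running times -/

/-- The program `p`, started in `σ`, halts in a state and after a time that satisfy `Q`. -/
def wp (S W : ℕ) (p : Program) (Q : State → ℕ → Prop) (σ : State) : Prop :=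
  ∃ σ' t, Exec S W p σ σ' t ∧ Q σ' t

section
variable {S W : ℕ} {Q Q' : State → ℕ → Prop} {σ : State}

lemma wp.mono {p : Program} (h : wp S W p Q σ) (hQ : ∀ σ' t, Q σ' t → Q' σ' t) :
    wp S W p Q' σ := by
  obtain ⟨σ', t, he, hq⟩ := h
  exact ⟨σ', t, he, hQ _ _ hq⟩

lemma wp_skip : wp S W .skip Q σ ↔ Q σ 1 := by
  constructor
  · rintro ⟨σ', t, he, hq⟩
    cases he
    exact hq
  · exact fun h => ⟨_, _, .skip σ, h⟩

lemma wp_setI {v : ℕ} {e : IExpr} : wp S W (.setI v e) Q σ ↔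
    e.Ok S W σ ∧ Q { σ with ireg := Function.update σ.ireg v (e.val σ) } (e.cost + 1) := by
  constructor
  · rintro ⟨σ', t, he, hq⟩
    cases he with
    | setI _ _ _ he => exact ⟨he, hq⟩
  · exact fun h => ⟨_, _, .setI σ v e h.1, h.2⟩

lemma wp_storeI {a : ℕ} {i e : IExpr} : wp S W (.storeI a i e) Q σ ↔
    i.Ok S W σ ∧ i.val σ < S ∧ e.Ok S W σ ∧
      Q { σ with imem :=
            Function.update σ.imem a (Function.update (σ.imem a) (i.val σ) (e.val σ)) }
        (i.cost + e.cost + 1) := by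
  constructor
  · rintro ⟨σ', t, he, hq⟩
    cases he with
    | storeI _ _ _ _ hi hS he => exact ⟨hi, hS, he, hq⟩
  · exact fun h => ⟨_, _, .storeI σ a i e h.1 h.2.1 h.2.2.1, h.2.2.2⟩

lemma wp_storeR {a : ℕ} {i : IExpr} {e : RExpr} : wp S W (.storeR a i e) Q σ ↔
    i.Ok S W σ ∧ i.val σ < S ∧ e.Ok S W σ ∧
      Q { σ with rmem :=
            Function.update σ.rmem a (Function.update (σ.rmem a) (i.val σ) (e.val σ)) }
        (i.cost + e.cost + 1) := by
  constructor
  · rintro ⟨σ', t, he, hq⟩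
    cases he with
    | storeR _ _ _ _ hi hS he => exact ⟨hi, hS, he, hq⟩
  · exact fun h => ⟨_, _, .storeR σ a i e h.1 h.2.1 h.2.2.1, h.2.2.2⟩

lemma wp_seq {p q : Program} : wp S W (.seq p q) Q σ ↔
    wp S W p (fun σ₁ t => wp S W q (fun σ₂ u => Q σ₂ (t + u)) σ₁) σ := by
  constructor
  · rintro ⟨σ', t, he, hq⟩
    cases he with
    | seq h₁ h₂ => exact ⟨_, _, h₁, _, _, h₂, hq⟩
  · rintro ⟨σ₁, t, h₁, σ₂, u, h₂, hq⟩
    exact ⟨_, _, .seq h₁ h₂, hq⟩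

lemma wp_cond {b : Test} {p q : Program} : wp S W (.cond b p q) Q σ ↔
    b.Ok S W σ ∧ (b.Holds σ → wp S W p (fun σ' t => Q σ' (b.cost + 1 + t)) σ) ∧
      (¬ b.Holds σ → wp S W q (fun σ' t => Q σ' (b.cost + 1 + t)) σ) := by
  constructor
  · rintro ⟨σ', t, he, hq⟩
    cases he with
    | cond_true hok hb hp => exact ⟨hok, fun _ => ⟨_, _, hp, hq⟩, fun h => absurd hb h⟩
    | cond_false hok hb hp => exact ⟨hok, fun h => absurd h hb, fun _ => ⟨_, _, hp, hq⟩⟩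
  · rintro ⟨hok, h₁, h₂⟩
    by_cases hb : b.Holds σ
    · obtain ⟨σ', t, he, hq⟩ := h₁ hb
      exact ⟨_, _, .cond_true hok hb he, hq⟩
    · obtain ⟨σ', t, he, hq⟩ := h₂ hb
      exact ⟨_, _, .cond_false hok hb he, hq⟩

/-- A single unfolding of the loop. Termination has to come from an induction wherever the rule is
applied. -/
lemma wp_loop {b : Test} {p : Program} : wp S W (.loop b p) Q σ ↔
    b.Ok S W σ ∧
      (b.Holds σ → wp S W p (fun σ₁ t => wp S W (.loop b p)
        (fun σ₂ u => Q σ₂ (b.cost + 1 + t + u)) σ₁) σ) ∧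
      (¬ b.Holds σ → Q σ (b.cost + 1)) := by
  constructor
  · rintro ⟨σ', t, he, hq⟩
    cases he with
    | loop_true hok hb hp hl =>
      exact ⟨hok, fun _ => ⟨_, _, hp, _, _, hl, hq⟩, fun h => absurd hb h⟩
    | loop_false hok hb => exact ⟨hok, fun h => absurd h hb, fun _ => hq⟩
  · rintro ⟨hok, h₁, h₂⟩
    by_cases hb : b.Holds σ
    · obtain ⟨σ', t, he, σ₂, u, hl, hq⟩ := h₁ hb
      exact ⟨_, _, .loop_true hok hb he hl, hq⟩
    · exact ⟨_, _, .loop_false hok hb, h₂ hb⟩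

end

/-- `for v < m do p`, where `m` is an integer register. -/
def Program.forBelow (v m : ℕ) (p : Program) : Program :=
  .seq (.setI v (.const 0))
    (.loop (.ltI (.reg v) (.reg m)) (.seq p (.setI v (.add (.reg v) (.const 1)))))

/-- The invariant `I i` refers to the state in which the counter already equals `i`, hence the
update in the conclusion of `hstep`. The multiplicative form of the time bound lets nested loops
compose without lower-order terms. -/
lemma wp_forBelow {S W v m M T : ℕ} {p : Program} {σ : State} (I : ℕ → State → Prop)
    (hvm : v ≠ m) (hM : 1 ≤ M) (hW : M + 1 ≤ W)
    (hm : σ.ireg m = M) (hT : 1 ≤ T)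
    (hinit : I 0 { σ with ireg := Function.update σ.ireg v 0 })
    (hstep : ∀ i < M, ∀ τ : State, τ.ireg v = i → τ.ireg m = M → I i τ →
      wp S W p (fun τ' t => t ≤ T ∧ τ'.ireg v = i ∧ τ'.ireg m = M ∧
        I (i + 1) { τ' with ireg := Function.update τ'.ireg v (i + 1) }) τ) :
    wp S W (.forBelow v m p) (fun τ t => t ≤ 15 * (M * T) ∧ τ.ireg v = M ∧
      τ.ireg m = M ∧ I M τ) σ := by
  -- Induction on the number `k` of remaining rounds. A round costs 8 beyond the body, 4 each for
  -- the test and the increment, and the final failing test costs 4.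
  have key : ∀ k i, i + k = M → ∀ τ : State, τ.ireg v = i → τ.ireg m = M → I i τ →
      wp S W (.loop (.ltI (.reg v) (.reg m)) (.seq p (.setI v (.add (.reg v) (.const 1)))))
        (fun τ' t => t ≤ k * (T + 8) + 4 ∧ τ'.ireg v = M ∧ τ'.ireg m = M ∧ I M τ') τ := by
    intro k
    induction k with
    | zero =>
      intro i hi τ hv hm hI
      obtain rfl : i = M := by omega
      rw [wp_loop]
      refine ⟨by simp [Test.Ok, IExpr.Ok]; omega, fun h => ?_, fun _ => ?_⟩
      · simp [Test.Holds, IExpr.val] at h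
        omega
      · simpa [Test.cost, IExpr.cost] using ⟨hv, hm, hI⟩
    | succ k ih =>
      intro i hi τ hv hm hI
      rw [wp_loop]
      refine ⟨by simp [Test.Ok, IExpr.Ok]; omega, fun _ => ?_, fun h => ?_⟩
      · rw [wp_seq]
        refine (hstep i (by omega) τ hv hm hI).mono ?_
        rintro τ' t ⟨ht, hv', hm', hI'⟩
        rw [wp_setI]
        refine ⟨by simp [IExpr.Ok, IExpr.val, hv']; omega, ?_⟩
        refine (ih (i + 1) (by omega) _ ?_ ?_ ?_).mono ?_
        · simp [IExpr.val, hv']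
        · simpa [IExpr.val, Function.update_of_ne hvm.symm] using hm'
        · simpa [IExpr.val, hv'] using hI'
        · rintro τ'' u ⟨hu, h⟩
          refine ⟨?_, h⟩
          simp only [Test.cost, IExpr.cost]
          rw [add_mul]
          omega
      · simp [Test.Holds, IExpr.val] at h
        omega
  rw [Program.forBelow, wp_seq, wp_setI]
  refine ⟨by simp [IExpr.Ok], (key M 0 (by omega) _ ?_ ?_ ?_).mono ?_⟩
  · simp [IExpr.val]
  · simpa [Function.update_of_ne hvm.symm] using hm
  · simpa [IExpr.val] using hinit
  · rintro τ t ⟨ht, h⟩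
    refine ⟨?_, h⟩
    simp only [IExpr.cost]
    -- With the initialization this is `M * (T + 8) + 6 ≤ 15 * (M * T)`, by `1 ≤ M` and `1 ≤ T`.
    nlinarith

end RealRAM

/-! ## Caps on indexed points, built from the highest vertex downwards -/

/-- The orientation of three points given by their indices. -/
def turn (u v : ℕ → ℝ) (i j k : ℕ) : ℝ :=
  orient (u i, v i) (u j, v j) (u k, v k)

/-- The indices list, from left to right, the vertices of a top cap with distinct ordinates. -/
def IsCapList (u v : ℕ → ℝ) (Q : List ℕ) : Prop :=
  Q.Pairwise (fun i j => u i < u j) ∧ Q.Pairwise (fun i j => v i ≠ v j) ∧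
    Q.Triplewise (fun i j k => turn u v i j k < 0)

/-- `Reach u v N a b c d Q`: the cap `Q` arises from its highest vertex by adding vertices in
decreasing order of their ordinates. Its leftmost edge is `a b` and its rightmost edge is `d c`,
where `a = b` (or `c = d`) if nothing has been added on that side. -/
inductive Reach (u v : ℕ → ℝ) (N : ℕ) : ℕ → ℕ → ℕ → ℕ → List ℕ → Prop where
  | peak {a : ℕ} (ha : a < N) : Reach u v N a a a a [a]
  | left {a b c d e : ℕ} {Q : List ℕ} (h : Reach u v N b e c d Q) (ha : a < N)
      (hu : u a < u b) (hv : v a < v b) (hc : v a < v c) (ht : e = b ∨ turn u v a b e < 0) :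
      Reach u v N a b c d (a :: Q)
  | right {a b c d e : ℕ} {Q : List ℕ} (h : Reach u v N a b d e Q) (hc : c < N)
      (hu : u d < u c) (hv : v c < v d) (ha : v c < v a) (ht : e = d ∨ turn u v e d c < 0) :
      Reach u v N a b c d (Q ++ [c])

/-! ### Local convexity along a monotone chain -/

/-- Multiplied by the positive width `r.1 - q.1`, each of the two orientations is a combination of
the two given ones with positive coefficients. This is what makes the end edge a sufficient summary
of a partial cap. -/
lemma orient_chain {p q r s : ℝ × ℝ} (hpq : p.1 < q.1) (hqr : q.1 < r.1) (hrs : r.1 < s.1)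
    (h₁ : orient p q r < 0) (h₂ : orient q r s < 0) : orient p q s < 0 ∧ orient p r s < 0 := by
  simp only [orient] at *
  have e : ∀ A B : ℝ, A < 0 → 0 < B → A * B < 0 := fun A B => mul_neg_of_neg_of_pos
  constructor
  · have key : (r.1 - q.1) * ((q.1 - p.1) * (s.2 - p.2) - (q.2 - p.2) * (s.1 - p.1)) =
        ((q.1 - p.1) * (r.2 - p.2) - (q.2 - p.2) * (r.1 - p.1)) * (s.1 - q.1) +
        ((r.1 - q.1) * (s.2 - q.2) - (r.2 - q.2) * (s.1 - q.1)) * (q.1 - p.1) := by ring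
    have a := e _ (s.1 - q.1) h₁ (by linarith)
    have b := e _ (q.1 - p.1) h₂ (by linarith)
    by_contra hn
    have := mul_nonneg (sub_nonneg.2 hqr.le) (not_lt.1 hn)
    linarith
  · have key : (r.1 - q.1) * ((r.1 - p.1) * (s.2 - p.2) - (r.2 - p.2) * (s.1 - p.1)) =
        ((q.1 - p.1) * (r.2 - p.2) - (q.2 - p.2) * (r.1 - p.1)) * (s.1 - r.1) +
        ((r.1 - q.1) * (s.2 - q.2) - (r.2 - q.2) * (s.1 - q.1)) * (r.1 - p.1) := by ring
    have a := e _ (s.1 - r.1) h₁ (by linarith)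
    have b := e _ (r.1 - p.1) h₂ (by linarith)
    by_contra hn
    have := mul_nonneg (sub_nonneg.2 hqr.le) (not_lt.1 hn)
    linarith

lemma turn_neg_of_peak {u v : ℕ → ℝ} {i j k : ℕ} (hij : u i < u j) (hjk : u j < u k)
    (hi : v i < v j) (hk : v k < v j) : turn u v i j k < 0 := by
  simp only [turn, orient]
  nlinarith [mul_pos (sub_pos.2 hij) (sub_pos.2 hk), mul_pos (sub_pos.2 hjk) (sub_pos.2 hi)]

/-- The middle point lies strictly above the chord, hence strictly above the lower endpoint of the
chord. -/
lemma lower_end_of_turn_neg {u v : ℕ → ℝ} {i j k : ℕ} (hij : u i < u j) (hjk : u j < u k)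
    (h : turn u v i j k < 0) (hik : v i ≤ v k) : v i < v j := by
  simp only [turn, orient] at h
  by_contra hn
  nlinarith [mul_nonneg (sub_pos.2 hij).le (sub_nonneg.2 hik),
    mul_nonneg (sub_nonneg.2 (not_lt.1 hn)) (sub_pos.2 (hij.trans hjk)).le]

lemma turn_mirror (u v : ℕ → ℝ) (i j k : ℕ) : turn (-u) v k j i = turn u v i j k := by
  simp only [turn, orient, Pi.neg_apply]
  ring

/-- Reflection in a vertical line together with reversal of the list. It reduces every statement
about right ends to one about left ends. -/
lemma isCapList_mirror {u v : ℕ → ℝ} {Q : List ℕ} :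
    IsCapList (-u) v Q.reverse ↔ IsCapList u v Q := by
  simp [IsCapList, List.pairwise_reverse, List.triplewise_reverse, turn_mirror, ne_comm]

/-- `a b` is the edge at the left end of `Q`, or `a = b` is the highest vertex of `Q`. -/
def LeftEnd (v : ℕ → ℝ) (a b : ℕ) (Q : List ℕ) : Prop :=
  (b = a ∧ ∃ R, Q = a :: R ∧ ∀ q ∈ R, v q < v a) ∨ ∃ R, Q = a :: b :: R

lemma LeftEnd.append {v : ℕ → ℝ} {a b c : ℕ} {Q : List ℕ} (h : LeftEnd v a b Q)
    (hc : v c < v a) : LeftEnd v a b (Q ++ [c]) := by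
  rcases h with ⟨rfl, R, rfl, h⟩ | ⟨R, rfl⟩
  · refine Or.inl ⟨rfl, R ++ [c], rfl, ?_⟩
    simpa [or_imp, forall_and] using ⟨h, hc⟩
  · exact Or.inr ⟨R ++ [c], rfl⟩

lemma LeftEnd.cons {v : ℕ → ℝ} {a b : ℕ} {Q : List ℕ} (h : LeftEnd v a b Q) (c : ℕ) :
    LeftEnd v c a (c :: Q) := by
  rcases h with ⟨rfl, R, rfl, h⟩ | ⟨R, rfl⟩
  · exact Or.inr ⟨R, rfl⟩
  · exact Or.inr ⟨b :: R, rfl⟩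

/-- Only the turn at `b` is tested. If `b` is the peak, all turns at `b` are clockwise because its
two neighbours on either side are lower; otherwise the turn `a b e` propagates along the chain by
`orient_chain`. Being lower than all of `Q` keeps the ordinates distinct. -/
lemma IsCapList.cons {u v : ℕ → ℝ} {a b e : ℕ} {Q : List ℕ} (h : IsCapList u v Q)
    (hend : LeftEnd v b e Q) (hlow : ∀ q ∈ Q, v a < v q) (hu : u a < u b)
    (ht : e = b ∨ turn u v a b e < 0) : IsCapList u v (a :: Q) := by
  obtain ⟨R, rfl⟩ : ∃ R, Q = b :: R := by
    rcases hend with ⟨rfl, R, rfl, h⟩ | ⟨R, rfl⟩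
    exacts [⟨R, rfl⟩, ⟨e :: R, rfl⟩]
  obtain ⟨h₁, h₂, h₃⟩ := h
  have hb : ∀ q ∈ R, u b < u q := (List.pairwise_cons.1 h₁).1
  -- First the triples that start with the new edge `a b`.
  have hsnd : ∀ q ∈ R, turn u v a b q < 0 := by
    rcases hend with ⟨rfl, R', hR, hv⟩ | ⟨R', hR⟩
    · cases hR
      exact fun q hq => turn_neg_of_peak hu (hb q hq) (hlow _ (by simp)) (hv q hq)
    · cases hR
      have hbe : u b < u e := hb e (by simp)
      have hae : turn u v a b e < 0 := by
        rcases ht with rfl | ht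
        · exact absurd hbe (lt_irrefl _)
        · exact ht
      intro q hq
      rcases List.mem_cons.1 hq with rfl | hq'
      · exact hae
      · have he : u e < u q := (List.pairwise_cons.1 (List.pairwise_cons.1 h₁).2).1 q hq'
        have ht' : turn u v b e q < 0 :=
          (List.pairwise_cons.1 (List.triplewise_cons.1 h₃).1).1 q hq'
        exact (orient_chain (p := (u a, v a)) (q := (u b, v b)) (r := (u e, v e))
          (s := (u q, v q)) hu hbe he hae ht').1
  refine ⟨List.pairwise_cons.2 ⟨?_, h₁⟩, List.pairwise_cons.2 ⟨fun q hq => (hlow q hq).ne, h₂⟩,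
    List.triplewise_cons.2 ⟨List.pairwise_cons.2 ⟨hsnd, ?_⟩, h₃⟩⟩
  · intro q hq
    rcases List.mem_cons.1 hq with rfl | hq
    exacts [hu, hu.trans (hb q hq)]
  -- The remaining triples `a q r` follow from the turns `a b q` and `b q r`.
  · have hR := (List.triplewise_cons.1 h₃).1
    have hR' := (List.pairwise_cons.1 h₁).2
    refine (hR.and hR').imp_of_mem ?_
    rintro q r hq hr ⟨hqr, huqr⟩
    exact (orient_chain (p := (u a, v a)) (q := (u b, v b)) (r := (u q, v q))
      (s := (u r, v r)) hu (hb q hq) huqr (hsnd q hq) hqr).2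

/-- The fourth clause drives the induction: every vertex is at least as high as one of the ends, so
a new vertex below both ends is below the whole cap, as `IsCapList.cons` requires. -/
lemma Reach.invariant {u v : ℕ → ℝ} {N a b c d : ℕ} {Q : List ℕ} (h : Reach u v N a b c d Q) :
    IsCapList u v Q ∧ LeftEnd v a b Q ∧ LeftEnd v c d Q.reverse ∧
      (∀ q ∈ Q, v a ≤ v q ∨ v c ≤ v q) ∧ ∀ q ∈ Q, q < N := by
  induction h with
  | peak ha => simpa [IsCapList, LeftEnd] using ha
  | @left a b c d e Q h ha hu hv hc ht ih =>
    obtain ⟨h₁, h₂, h₃, h₄, h₅⟩ := ih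
    have hlow : ∀ q ∈ Q, v a < v q := fun q hq =>
      (h₄ q hq).elim (hv.trans_le ·) (hc.trans_le ·)
    refine ⟨h₁.cons h₂ hlow hu ht, h₂.cons a, ?_, ?_, ?_⟩
    · rw [List.reverse_cons]
      exact h₃.append hc
    · simpa using fun q hq => Or.inl (hlow q hq).le
    · simpa using ⟨ha, h₅⟩
  | @right a b c d e Q h hc hu hv ha ht ih =>
    obtain ⟨h₁, h₂, h₃, h₄, h₅⟩ := ih
    have hlow : ∀ q ∈ Q, v c < v q := fun q hq =>
      (h₄ q hq).elim (ha.trans_le ·) (hv.trans_le ·)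
    refine ⟨?_, h₂.append ha, ?_, ?_, ?_⟩
    · rw [← isCapList_mirror, List.reverse_append]
      refine (isCapList_mirror.2 h₁).cons h₃ (by simpa using hlow) (neg_lt_neg hu) ?_
      rwa [turn_mirror]
    · rw [List.reverse_append]
      exact h₃.cons c
    · simp only [List.mem_append, List.mem_singleton]
      rintro q (hq | rfl)
      exacts [Or.inr (hlow q hq).le, Or.inr le_rfl]
    · simp only [List.mem_append, List.mem_singleton]
      rintro q (hq | rfl)
      exacts [h₅ q hq, hc]

/-! ### Every cap is built from its highest vertex -/

lemma IsCapList.sublist {u v : ℕ → ℝ} {Q R : List ℕ} (h : IsCapList u v Q) (hR : R.Sublist Q) :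
    IsCapList u v R := by
  refine ⟨h.1.sublist hR, h.2.1.sublist hR, ?_⟩
  have h₃ := h.2.2
  clear h
  induction hR with
  | slnil => exact h₃
  | cons a hR ih => exact ih (List.triplewise_cons.1 h₃).2
  | cons_cons a hR ih =>
    have := List.triplewise_cons.1 h₃
    exact List.triplewise_cons.2 ⟨this.1.sublist hR, ih this.2⟩

/-- A cap whose left end is lower than its right end has its lowest vertex at the left end. -/
lemma IsCapList.lt_of_head_lt {u v : ℕ → ℝ} {a c : ℕ} {Q : List ℕ}
    (h : IsCapList u v (a :: (Q ++ [c]))) (hac : v a < v c) : ∀ q ∈ Q ++ [c], v a < v q := by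
  intro q hq
  rcases List.mem_append.1 hq with hq | hq
  · obtain ⟨h₁, -, h₃⟩ := h
    have hp := List.pairwise_cons.1 h₁
    have ht := (List.pairwise_append.1 (List.triplewise_cons.1 h₃).1).2.2 q hq c (by simp)
    have hqc := (List.pairwise_append.1 hp.2).2.2 q hq c (by simp)
    exact lower_end_of_turn_neg (hp.1 q (by simp [hq])) hqc ht hac.le
  · rw [List.mem_singleton.1 hq]
    exact hac

lemma Reach.mirror {u v : ℕ → ℝ} {N a b c d : ℕ} {Q : List ℕ} (h : Reach u v N a b c d Q) :
    Reach (-u) v N c d a b Q.reverse := by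
  induction h with
  | peak ha => exact .peak ha
  | left h ha hu hv hc ht ih =>
    rw [List.reverse_cons]
    exact .right ih ha (neg_lt_neg hu) hv hc (by rwa [turn_mirror])
  | right h hc hu hv ha ht ih =>
    rw [List.reverse_append]
    exact .left ih hc (neg_lt_neg hu) hv ha (by rwa [turn_mirror])

/-- A cap from which the removal of the left end leaves a reachable cap is reachable. -/
lemma IsCapList.reach_cons {u v : ℕ → ℝ} {N a c : ℕ} {Q : List ℕ}
    (h : IsCapList u v (a :: (Q ++ [c]))) (hac : v a < v c) (ha : a < N)
    (hQ : ∃ a' b c' d, Reach u v N a' b c' d (Q ++ [c])) :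
    ∃ a' b c' d, Reach u v N a' b c' d (a :: (Q ++ [c])) := by
  obtain ⟨b, e, c', d, hr⟩ := hQ
  obtain ⟨-, hl, hr', -⟩ := hr.invariant
  have hc : c' = c := by
    rw [List.reverse_append] at hr'
    rcases hr' with ⟨_, R, hR, _⟩ | ⟨R, hR⟩ <;> 
      simpa using congrArg List.head? hR.symm
  subst hc
  have hlow := h.lt_of_head_lt hac
  rcases hl with ⟨rfl, R, hR, _⟩ | ⟨R, hR⟩
  · rw [hR] at h hlow hr ⊢
    exact ⟨a, e, c', d, .left hr ha ((List.pairwise_cons.1 h.1).1 e (by simp))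
      (hlow e (by simp)) hac (Or.inl rfl)⟩
  · rw [hR] at h hlow hr ⊢
    exact ⟨a, b, c', d, .left hr ha ((List.pairwise_cons.1 h.1).1 b (by simp))
      (hlow b (by simp)) hac
      (Or.inr ((List.pairwise_cons.1 (List.triplewise_cons.1 h.2.2).1).1 e (by simp)))⟩

/-- Induction on the size: the ends have different ordinates, so the lower one can be removed and
then put back as the last vertex added. If it is the right end, the mirrored cap is treated. -/
lemma IsCapList.exists_reach {u v : ℕ → ℝ} {N : ℕ} {Q : List ℕ} (h : IsCapList u v Q)
    (hN : ∀ q ∈ Q, q < N) (hne : Q ≠ []) : ∃ a b c d, Reach u v N a b c d Q := by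
  induction hn : Q.length generalizing Q with
  | zero => exact absurd (List.length_eq_zero_iff.1 hn) hne
  | succ m ih =>
    obtain ⟨a, R, rfl⟩ := List.exists_cons_of_ne_nil hne
    rcases List.eq_nil_or_concat R with rfl | ⟨S, c, rfl⟩
    · exact ⟨a, a, a, a, .peak (hN a (by simp))⟩
    · rw [List.concat_eq_append] at *
      have hac : v a ≠ v c := (List.pairwise_cons.1 h.2.1).1 c (by simp)
      rcases hac.lt_or_gt with hac | hac
      · exact h.reach_cons hac (hN a (by simp)) (ih (h.sublist (List.sublist_cons_self _ _))
          (fun q hq => hN q (List.mem_cons_of_mem _ hq)) (by simp) (by simpa using hn))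
      · have hS := ih (Q := a :: S) (h.sublist (by simp))
          (fun q hq => hN q (by simp at hq ⊢; tauto)) (by simp) (by simpa using hn)
        obtain ⟨a₁, b₁, c₁, d₁, h₁⟩ := hS
        have h' : IsCapList (-u) v (c :: (S.reverse ++ [a])) := by
          simpa using isCapList_mirror.2 h
        have h₂ := h₁.mirror
        rw [List.reverse_cons] at h₂
        obtain ⟨a₃, b₃, c₃, d₃, h₃⟩ := h'.reach_cons hac (hN c (by simp)) ⟨_, _, _, _, h₂⟩
        have h₄ := h₃.mirror
        rw [neg_neg] at h₄
        exact ⟨_, _, _, _, by simpa using h₄⟩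

lemma Reach.lt {u v : ℕ → ℝ} {N a b c d : ℕ} {Q : List ℕ} (h : Reach u v N a b c d Q) :
    a < N ∧ b < N ∧ c < N ∧ d < N := by
  induction h with grind

lemma Reach.length_pos {u v : ℕ → ℝ} {N a b c d : ℕ} {Q : List ℕ} (h : Reach u v N a b c d Q) :
    0 < Q.length := by
  cases h <;> simp

namespace RealRAM

/-! ## The dynamic program -/

/-- The address of the table entry for the end edges `a b` and `d c`. -/
def code (N a c b d : ℕ) : ℕ := ((a * N + c) * N + b) * N + d

lemma pair_inj {N x y b b' : ℕ} (hb : b < N) (hb' : b' < N) (h : x * N + b = y * N + b') :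
    x = y ∧ b = b' := by
  have hN : 0 < N := by omega
  have h₁ := congrArg (· / N) h
  have h₂ := congrArg (· % N) h
  simp only [mul_comm _ N, Nat.mul_add_div hN, Nat.mul_add_mod, Nat.div_eq_of_lt hb,
    Nat.div_eq_of_lt hb', Nat.mod_eq_of_lt hb, Nat.mod_eq_of_lt hb'] at h₁ h₂
  omega

lemma pair_lt_pair {N x y b : ℕ} (b' : ℕ) (hb : b < N) (h : x < y) :
    x * N + b < y * N + b' := by
  nlinarith

lemma pair_lt {N M x b : ℕ} (hb : b < N) (h : x < M) : x * N + b < M * N := by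
  nlinarith

lemma code_inj {N a b c d a' b' c' d' : ℕ} (hb : b < N) (hc : c < N) (hd : d < N)
    (hb' : b' < N) (hc' : c' < N) (hd' : d' < N) (h : code N a c b d = code N a' c' b' d') :
    a = a' ∧ c = c' ∧ b = b' ∧ d = d' := by
  obtain ⟨h, h₁⟩ := pair_inj hd hd' h
  obtain ⟨h, h₂⟩ := pair_inj hb hb' h
  obtain ⟨h, h₃⟩ := pair_inj hc hc' h
  exact ⟨h, h₃, h₂, h₁⟩

/-- The bounds on the partial results of the address computation are there because the machine
checks every intermediate integer against `W`. -/
lemma code_bound {N a b c d : ℕ} (ha : a < N) (hb : b < N) (hc : c < N) (hd : d < N) :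
    a * N ≤ code N a c b d ∧ a * N + c ≤ code N a c b d ∧
    (a * N + c) * N ≤ code N a c b d ∧ (a * N + c) * N + b ≤ code N a c b d ∧
    ((a * N + c) * N + b) * N ≤ code N a c b d ∧ code N a c b d < N ^ 4 := by
  have hN : 1 ≤ N := by omega
  have h₁ : a * N + c ≤ (a * N + c) * N := Nat.le_mul_of_pos_right _ hN
  have h₂ : (a * N + c) * N + b ≤ ((a * N + c) * N + b) * N := Nat.le_mul_of_pos_right _ hN
  have h₃ := pair_lt hd (pair_lt hb (pair_lt hc ha))
  have h₄ : N * N * N * N = N ^ 4 := by ring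
  simp only [code]
  omega

/-- Here `a` is the leading digit and drops to `b`, so the later digits, including the new `e`, are
irrelevant. -/
lemma code_lt_left {N a b c d e : ℕ} (hc : c < N) (hd : d < N) (he : e < N) (h : b < a) :
    code N b c e d < code N a c b d :=
  pair_lt_pair _ hd (pair_lt_pair _ he (pair_lt_pair _ hc h))

/-- The leading digit `a` stays and the second digit drops from `c` to `d`. This is why both ends
precede `b` and `d` in the address. -/
lemma code_lt_right {N a b c d e : ℕ} (hb : b < N) (he : e < N) (h : d < c) :
    code N a d b e < code N a c b d :=
  pair_lt_pair _ he (pair_lt_pair _ hb (by omega))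

section
variable (u v : ℕ → ℝ) (N : ℕ) (F P : ℕ → ℕ)

/-- How the table entry for `a b` and `d c` was computed. -/
def Step (a b c d : ℕ) : Prop :=
  (a = b ∧ b = c ∧ c = d ∧ F (code N a c b d) = 1) ∨
  (v a < v c ∧ u a < u b ∧ v a < v b ∧
    (P (code N a c b d) = b ∨ turn u v a b (P (code N a c b d)) < 0) ∧
    0 < F (code N b c (P (code N a c b d)) d) ∧
    F (code N a c b d) = F (code N b c (P (code N a c b d)) d) + 1) ∨
  (v c < v a ∧ u d < u c ∧ v c < v d ∧
    (P (code N a c b d) = d ∨ turn u v (P (code N a c b d)) d c < 0) ∧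
    0 < F (code N a d b (P (code N a c b d))) ∧
    F (code N a c b d) = F (code N a d b (P (code N a c b d))) + 1)

/-- The table entry for `a b` and `d c` is the maximum size of a cap with these end edges. -/
def Entry (a b c d : ℕ) : Prop :=
  (∀ Q, Reach u v N a b c d Q → Q.length ≤ F (code N a c b d)) ∧ P (code N a c b d) < N ∧
  (0 < F (code N a c b d) →
    Step u v N F P a b c d ∧ ∃ Q, Reach u v N a b c d Q ∧ Q.length = F (code N a c b d))

/-- The table entries below `K` are correct. -/
def Table (K : ℕ) : Prop :=
  ∀ a b c d, a < N → b < N → c < N → d < N → code N a c b d < K → Entry u v N F P a b c d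

end

/-! ### Computing one table entry -/

/-- The address expression for a table entry. -/
def codeE (a c b d : ℕ) : IExpr :=
  .add (.mul (.add (.mul (.add (.mul (.reg a) (.reg 2)) (.reg c)) (.reg 2)) (.reg b)) (.reg 2))
    (.reg d)

lemma codeE_spec {S W N ra rc rb rd : ℕ} {σ : State} (hN : σ.ireg 2 = N) (hW : N ^ 4 ≤ W)
    (ha : σ.ireg ra < N) (hb : σ.ireg rb < N) (hc : σ.ireg rc < N) (hd : σ.ireg rd < N) :
    (codeE ra rc rb rd).Ok S W σ ∧
      (codeE ra rc rb rd).val σ = code N (σ.ireg ra) (σ.ireg rc) (σ.ireg rb) (σ.ireg rd) := by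
  have h := code_bound ha hb hc hd
  have hNW : N ≤ W := (Nat.le_self_pow (by norm_num) N).trans hW
  simp only [codeE, IExpr.Ok, IExpr.val, hN, code, and_true] at *
  omega

/-- The expression for the orientation of three points. -/
def turnE (i j k : ℕ) : RExpr :=
  .sub (.mul (.sub (.load 4 (.reg j)) (.load 4 (.reg i)))
      (.sub (.load 5 (.reg k)) (.load 5 (.reg i))))
    (.mul (.sub (.load 5 (.reg j)) (.load 5 (.reg i)))
      (.sub (.load 4 (.reg k)) (.load 4 (.reg i))))

/-- Disjunction of tests. -/
def Test.or (b c : Test) : Test := .not (.and (.not b) (.not c))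

lemma Test.or_holds {b c : Test} {σ : State} :
    (b.or c).Holds σ ↔ b.Holds σ ∨ c.Holds σ := by
  simp only [Test.or, Test.Holds]
  tauto

lemma Test.or_ok {b c : Test} {S W : ℕ} {σ : State} :
    (b.or c).Ok S W σ ↔ b.Ok S W σ ∧ c.Ok S W σ := Iff.rfl

/-- Search for the parent of a table entry: among the indices in register `8` that pass the test,
maximize the table entry at the given address. -/
def search (b : Test) (i : IExpr) : Program :=
  .forBelow 8 2 (.cond (.and b (.and (.ltI (.const 0) (.load 0 i))
      (.not (.ltI (.load 0 i) (.reg 9)))))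
    (.seq (.setI 9 (.add (.load 0 i) (.const 1))) (.setI 10 (.reg 8))) .skip)

/-- The two states have the same memory and agree in the registers other than `8`, `9`, `10`. -/
def AgreeSearch (σ σ' : State) : Prop :=
  (∀ r, r ≠ 8 → r ≠ 9 → r ≠ 10 → σ'.ireg r = σ.ireg r) ∧ σ'.imem = σ.imem ∧ σ'.rmem = σ.rmem

lemma AgreeSearch.update {σ σ' : State} (h : AgreeSearch σ σ') {r : ℕ} (x : ℕ)
    (hr : r = 8 ∨ r = 9 ∨ r = 10) :
    AgreeSearch σ { σ' with ireg := Function.update σ'.ireg r x } := by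
  refine ⟨fun s h₁ h₂ h₃ => ?_, h.2⟩
  rw [← h.1 s h₁ h₂ h₃]
  exact Function.update_of_ne (by omega) _ _

/-- Register `9` holds one more than the best predecessor value and register `10` the index
attaining it. A table value of `0` means that no cap exists, so such candidates are skipped, and `0`
in register `9` means that none was found. -/
lemma search_spec {S W N : ℕ} {σ : State} {b : Test} {i : IExpr} (g : ℕ → ℕ) (p : ℕ → Prop)
    (hN1 : 1 ≤ N) (hW : N + 1 ≤ W) (hN : σ.ireg 2 = N)
    (h9 : σ.ireg 9 = 0) (h10 : σ.ireg 10 = 0) (hb : b.cost ≤ 50) (hi : i.cost ≤ 50)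
    (h : ∀ σ', AgreeSearch σ σ' → σ'.ireg 8 < N → b.Ok S W σ' ∧ (b.Holds σ' ↔ p (σ'.ireg 8)) ∧
      i.Ok S W σ' ∧ i.val σ' = g (σ'.ireg 8) ∧ g (σ'.ireg 8) < S ∧
      σ.imem 0 (g (σ'.ireg 8)) + 1 ≤ W) :
    wp S W (search b i) (fun τ t => t ≤ 15 * (N * 1000) ∧ AgreeSearch σ τ ∧
      (∀ e < N, p e → 0 < σ.imem 0 (g e) → σ.imem 0 (g e) + 1 ≤ τ.ireg 9) ∧
      ((τ.ireg 9 = 0 ∧ τ.ireg 10 = 0) ∨ (τ.ireg 10 < N ∧ p (τ.ireg 10) ∧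
        0 < σ.imem 0 (g (τ.ireg 10)) ∧ τ.ireg 9 = σ.imem 0 (g (τ.ireg 10)) + 1))) σ := by
  refine (wp_forBelow (I := fun k τ => AgreeSearch σ τ ∧ τ.ireg 9 ≤ W ∧
      (∀ e < k, p e → 0 < σ.imem 0 (g e) → σ.imem 0 (g e) + 1 ≤ τ.ireg 9) ∧
      ((τ.ireg 9 = 0 ∧ τ.ireg 10 = 0) ∨ (τ.ireg 10 < N ∧ p (τ.ireg 10) ∧
        0 < σ.imem 0 (g (τ.ireg 10)) ∧ τ.ireg 9 = σ.imem 0 (g (τ.ireg 10)) + 1)))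
    (M := N) (T := 1000) (by norm_num) hN1 hW hN (by norm_num) ?_ ?_).mono ?_
  · refine ⟨AgreeSearch.update ⟨fun _ _ _ _ => rfl, rfl, rfl⟩ _ (by simp), ?_, ?_, ?_⟩ <;>
      simp [h9, h10]
  · rintro e he τ h8 h2 ⟨hA, hW9, hmax, hcur⟩
    obtain ⟨hbo, hbh, hio, hiv, hgS, hgW⟩ := h τ hA (by omega)
    rw [h8] at hbh hiv hgS hgW
    rw [wp_cond]
    refine ⟨?_, fun hh => ?_, fun hh => ?_⟩
    · simp only [Test.Ok, IExpr.Ok, hiv, hA.2.1]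
      exact ⟨hbo, ⟨by omega, hio, hgS, by omega⟩, ⟨hio, hgS, by omega⟩, hW9⟩
    · simp only [Test.Holds, IExpr.val, hiv, hA.2.1, hbh] at hh
      rw [wp_seq, wp_setI]
      refine ⟨?_, ?_⟩
      · simp only [IExpr.Ok, IExpr.val, hiv, hA.2.1, hio, true_and]
        omega
      rw [wp_setI]
      refine ⟨?_, ?_⟩
      · simp [IExpr.Ok, h8]
        omega
      simp only [IExpr.val, hiv, hA.2.1]
      refine ⟨?_, ?_, ?_, ⟨fun r h₁ h₂ h₃ => ?_, rfl, hA.2.2⟩, ?_, ?_, Or.inr ?_⟩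
      · simp only [Test.cost, IExpr.cost]
        omega
      · simpa using h8
      · simpa using h2
      · simpa [Function.update_apply, h₁, h₂, h₃] using hA.1 r h₁ h₂ h₃
      · simpa using hgW
      · intro e' he' hp hF
        simp only [Function.update_apply]
        simp
        rcases Nat.lt_succ_iff_lt_or_eq.1 he' with he' | rfl
        · have := hmax e' he' hp hF
          omega
        · exact le_rfl
      · simp [h8, hh, he]
    · simp only [Test.Holds, IExpr.val, hiv, hA.2.1, hbh] at hh
      rw [wp_skip]
      refine ⟨?_, h8, h2, hA.update _ (by simp), ?_, ?_, ?_⟩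
      · simp only [Test.cost, IExpr.cost]
        omega
      · simpa using hW9
      · intro e' he' hp hF
        simp only [Function.update_apply]
        simp
        rcases Nat.lt_succ_iff_lt_or_eq.1 he' with he' | rfl
        · exact hmax e' he' hp hF
        · by_contra hn
          exact hh ⟨hp, hF, by omega⟩
      · simpa using hcur
  · rintro τ t ⟨ht, -, -, hA, -, h₁, h₂⟩
    exact ⟨ht, hA, h₁, h₂⟩

/-- Compute the table entry for the registers `3`, `4`, `5`, `6` (which hold `a`, `c`, `b`, `d`):
its value into register `9`, and the parent into register `10`. -/
def compute : Program :=
  .seq (.setI 9 (.const 0)) (.seq (.setI 10 (.const 0))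
    (.cond (.and (.eqI (.reg 3) (.reg 5)) (.and (.eqI (.reg 5) (.reg 4)) (.eqI (.reg 4) (.reg 6))))
      (.setI 9 (.const 1))
      (.cond (.and (.ltR (.load 5 (.reg 3)) (.load 5 (.reg 4)))
          (.and (.ltR (.load 4 (.reg 3)) (.load 4 (.reg 5)))
            (.ltR (.load 5 (.reg 3)) (.load 5 (.reg 5)))))
        (search ((Test.eqI (.reg 8) (.reg 5)).or (.ltR (turnE 3 5 8) (.const 0))) (codeE 5 4 8 6))
        (.cond (.and (.ltR (.load 5 (.reg 4)) (.load 5 (.reg 3)))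
            (.and (.ltR (.load 4 (.reg 6)) (.load 4 (.reg 4)))
              (.ltR (.load 5 (.reg 4)) (.load 5 (.reg 6)))))
          (search ((Test.eqI (.reg 8) (.reg 6)).or (.ltR (turnE 8 6 4) (.const 0)))
            (codeE 3 6 5 8))
          .skip))))

/-- The value `f` and the parent `p` are those of the entry for `a b` and `d c`. -/
def Computed (u v : ℕ → ℝ) (N : ℕ) (F : ℕ → ℕ) (a b c d f p : ℕ) : Prop :=
  p < N ∧ (∀ Q, Reach u v N a b c d Q → Q.length ≤ f) ∧
    (0 < f →
      (a = b ∧ b = c ∧ c = d ∧ f = 1) ∨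
      (v a < v c ∧ u a < u b ∧ v a < v b ∧ (p = b ∨ turn u v a b p < 0) ∧
        0 < F (code N b c p d) ∧ f = F (code N b c p d) + 1) ∨
      (v c < v a ∧ u d < u c ∧ v c < v d ∧ (p = d ∨ turn u v p d c < 0) ∧
        0 < F (code N a d b p) ∧ f = F (code N a d b p) + 1))

/-- The ordinates of `a` and `c` decide which vertex was added last, so at most one of the
constructors of `Reach` applies. In each branch, maximality comes from inverting the last step of a
cap and applying the table to its predecessor. -/
lemma compute_spec {S W N a b c d : ℕ} {u v : ℕ → ℝ} {σ : State}
    (hsort : ∀ k l, k < N → l < N → v l < v k → k < l)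
    (hN1 : 1 ≤ N) (hS : N ^ 4 ≤ S) (hW : N ^ 4 + 1 ≤ W) (hN : σ.ireg 2 = N)
    (h3 : σ.ireg 3 = a) (h4 : σ.ireg 4 = c) (h5 : σ.ireg 5 = b) (h6 : σ.ireg 6 = d)
    (ha : a < N) (hb : b < N) (hc : c < N) (hd : d < N) (hu : σ.rmem 4 = u) (hv : σ.rmem 5 = v)
    (hT : Table u v N (σ.imem 0) (σ.imem 1) (code N a c b d))
    (hF : ∀ k < code N a c b d, σ.imem 0 k + 1 ≤ W) :
    wp S W compute (fun τ t => t ≤ 15 * (N * 1000) + 100 ∧ AgreeSearch σ τ ∧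
      Computed u v N (σ.imem 0) a b c d (τ.ireg 9) (τ.ireg 10)) σ := by
  have hN4 : N ≤ N ^ 4 := Nat.le_self_pow (by norm_num) N
  rw [compute, wp_seq, wp_setI]
  refine ⟨by simp [IExpr.Ok], ?_⟩
  rw [wp_seq, wp_setI]
  refine ⟨by simp [IExpr.Ok], ?_⟩
  simp only [IExpr.val, IExpr.cost]
  set σ₁ : State := { σ with ireg := Function.update (Function.update σ.ireg 9 0) 10 0 } with hσ₁
  have hA : AgreeSearch σ σ₁ := AgreeSearch.update (AgreeSearch.update
    ⟨fun _ _ _ _ => rfl, rfl, rfl⟩ _ (by simp)) _ (by simp)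
  have r2 : σ₁.ireg 2 = N := by simpa [hσ₁] using hN
  have r3 : σ₁.ireg 3 = a := by simpa [hσ₁] using h3
  have r4 : σ₁.ireg 4 = c := by simpa [hσ₁] using h4
  have r5 : σ₁.ireg 5 = b := by simpa [hσ₁] using h5
  have r6 : σ₁.ireg 6 = d := by simpa [hσ₁] using h6
  have r9 : σ₁.ireg 9 = 0 := by simp [hσ₁]
  have r10 : σ₁.ireg 10 = 0 := by simp [hσ₁]
  have m4 : σ₁.rmem 4 = u := hu
  have m5 : σ₁.rmem 5 = v := hv
  have mi : σ₁.imem = σ.imem := rfl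
  clear_value σ₁
  have htrans : ∀ τ, AgreeSearch σ₁ τ → AgreeSearch σ τ := fun τ h =>
    ⟨fun r h₁ h₂ h₃ => (h.1 r h₁ h₂ h₃).trans (hA.1 r h₁ h₂ h₃), h.2.1.trans hA.2.1,
      h.2.2.trans hA.2.2⟩
  rw [wp_cond]
  refine ⟨by simp [Test.Ok, IExpr.Ok, r3, r4, r5, r6]; omega, fun hh => ?_, fun hne => ?_⟩
  · simp only [Test.Holds, IExpr.val, r3, r4, r5, r6] at hh
    rw [wp_setI]
    refine ⟨by simp [IExpr.Ok]; omega, ?_, hA.update _ (by simp), ?_⟩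
    · simp only [Test.cost, IExpr.cost]
      omega
    -- When all four indices coincide, an added vertex would have to lie strictly beside itself, so
    -- the singleton is the only cap.
    · obtain ⟨rfl, rfl, rfl⟩ := hh
      refine ⟨by simp [r10]; omega, fun Q hQ => ?_, fun _ => Or.inl (by simp [IExpr.val])⟩
      cases hQ with
      | peak => simp [IExpr.val]
      | left _ _ h => exact absurd h (lt_irrefl _)
      | right _ _ h => exact absurd h (lt_irrefl _)
  · simp only [Test.Holds, IExpr.val, r3, r4, r5, r6] at hne
    rw [wp_cond]
    refine ⟨by simp [Test.Ok, IExpr.Ok, RExpr.Ok, IExpr.val, r3, r4, r5]; omega,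
      fun hh => ?_, fun hL => ?_⟩
    · simp only [Test.Holds, IExpr.val, RExpr.val, r3, r4, r5, m4, m5] at hh
      obtain ⟨hac, hab, hab'⟩ := hh
      have hba := hsort b a hb ha hab'
      refine (search_spec (fun e => code N b c e d) (fun e => e = b ∨ turn u v a b e < 0)
        hN1 (by omega) r2 r9 r10 (by simp [Test.or, turnE, Test.cost, RExpr.cost, IExpr.cost])
        (by simp [codeE, IExpr.cost]) ?_).mono ?_
      · intro τ hτ h8
        have s2 := (hτ.1 2 (by simp) (by simp) (by simp)).trans r2
        have s3 := (hτ.1 3 (by simp) (by simp) (by simp)).trans r3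
        have s4 := (hτ.1 4 (by simp) (by simp) (by simp)).trans r4
        have s5 := (hτ.1 5 (by simp) (by simp) (by simp)).trans r5
        have s6 := (hτ.1 6 (by simp) (by simp) (by simp)).trans r6
        obtain ⟨hok, hval⟩ := codeE_spec (S := S) (ra := 5) (rc := 4) (rb := 8) (rd := 6) s2
          (show N ^ 4 ≤ W by omega) (by omega) h8 (by omega) (by omega)
        rw [s4, s5, s6] at hval
        have hlt : code N b c (τ.ireg 8) d < code N a c b d := code_lt_left hc hd h8 hba
        refine ⟨?_, ?_, hok, hval, ?_, ?_⟩
        · simp [Test.or_ok, Test.Ok, turnE, IExpr.Ok, RExpr.Ok, IExpr.val, s3, s5]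
          omega
        · simp [Test.or_holds, Test.Holds, turnE, RExpr.val, IExpr.val, s3, s5, hτ.2.2, m4, m5,
            turn, orient]
        · exact (code_bound hb h8 hc hd).2.2.2.2.2.trans_le hS
        · rw [mi]
          exact hF _ hlt
      · rintro τ t ⟨ht, hτ, hmax, hcur⟩
        rw [mi] at hmax hcur
        refine ⟨?_, htrans τ hτ, ?_, ?_, ?_⟩
        · simp only [Test.cost, RExpr.cost, IExpr.cost]
          omega
        · rcases hcur with h | h <;> omega
        · intro Q hQ
          cases hQ with
          | peak => exact absurd hac (lt_irrefl _)
          | @left _ _ _ _ e Q h _ _ _ _ ht =>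
            have he := h.lt.2.1
            have hE := hT b e c d hb he hc hd (code_lt_left hc hd he hba)
            have h₁ := hE.1 Q h
            have h₂ := h.length_pos
            have h₃ := hmax e he ht (by omega)
            simp only [List.length_cons]
            omega
          | right _ _ _ _ h => exact absurd h hac.not_gt
        · intro hpos
          rcases hcur with h | ⟨_, h₁, h₂, h₃⟩
          · omega
          · exact Or.inr (Or.inl ⟨hac, hab, hab', h₁, h₂, h₃⟩)
    · simp only [Test.Holds, IExpr.val, RExpr.val, r3, r4, r5, m4, m5] at hL
      rw [wp_cond]
      refine ⟨by simp [Test.Ok, IExpr.Ok, RExpr.Ok, IExpr.val, r3, r4, r6]; omega,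
        fun hh => ?_, fun hR => ?_⟩
      · simp only [Test.Holds, IExpr.val, RExpr.val, r3, r4, r6, m4, m5] at hh
        obtain ⟨hca, hdc, hcd⟩ := hh
        have hdc' := hsort d c hd hc hcd
        refine (search_spec (fun e => code N a d b e) (fun e => e = d ∨ turn u v e d c < 0)
          hN1 (by omega) r2 r9 r10 (by simp [Test.or, turnE, Test.cost, RExpr.cost, IExpr.cost])
          (by simp [codeE, IExpr.cost]) ?_).mono ?_
        · intro τ hτ h8
          have s2 := (hτ.1 2 (by simp) (by simp) (by simp)).trans r2
          have s3 := (hτ.1 3 (by simp) (by simp) (by simp)).trans r3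
          have s4 := (hτ.1 4 (by simp) (by simp) (by simp)).trans r4
          have s5 := (hτ.1 5 (by simp) (by simp) (by simp)).trans r5
          have s6 := (hτ.1 6 (by simp) (by simp) (by simp)).trans r6
          obtain ⟨hok, hval⟩ := codeE_spec (S := S) (ra := 3) (rc := 6) (rb := 5) (rd := 8) s2
            (show N ^ 4 ≤ W by omega) (by omega) (by omega) (by omega) h8
          rw [s3, s5, s6] at hval
          have hlt : code N a d b (τ.ireg 8) < code N a c b d := code_lt_right hb h8 hdc'
          refine ⟨?_, ?_, hok, hval, ?_, ?_⟩
          · simp [Test.or_ok, Test.Ok, turnE, IExpr.Ok, RExpr.Ok, IExpr.val, s4, s6]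
            omega
          · simp [Test.or_holds, Test.Holds, turnE, RExpr.val, IExpr.val, s4, s6, hτ.2.2, m4, m5,
              turn, orient]
          · exact (code_bound ha hb hd h8).2.2.2.2.2.trans_le hS
          · rw [mi]
            exact hF _ hlt
        · rintro τ t ⟨ht, hτ, hmax, hcur⟩
          rw [mi] at hmax hcur
          refine ⟨?_, htrans τ hτ, ?_, ?_, ?_⟩
          · simp only [Test.cost, RExpr.cost, IExpr.cost]
            omega
          · rcases hcur with h | h <;> omega
          · intro Q hQ
            cases hQ with
            | peak => exact absurd hca (lt_irrefl _)
            | left _ _ _ _ h => exact absurd h hca.not_gt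
            | @right _ _ _ _ e Q h _ _ _ _ ht =>
              have he := h.lt.2.2.2
              have hE := hT a b d e ha hb hd he (code_lt_right hb he hdc')
              have h₁ := hE.1 Q h
              have h₂ := h.length_pos
              have h₃ := hmax e he ht (by omega)
              simp only [List.length_append, List.length_singleton]
              omega
          · intro hpos
            rcases hcur with h | ⟨_, h₁, h₂, h₃⟩
            · omega
            · exact Or.inr (Or.inr ⟨hca, hdc, hcd, h₁, h₂, h₃⟩)
      · simp only [Test.Holds, IExpr.val, RExpr.val, r3, r4, r6, m4, m5] at hR
        rw [wp_skip]
        -- No constructor of `Reach` fits the indices, so the value `0` is right.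
        refine ⟨?_, hA, by omega, fun Q hQ => ?_, fun h => by omega⟩
        · simp only [Test.cost, RExpr.cost, IExpr.cost]
          omega
        · cases hQ with
          | peak => exact absurd ⟨rfl, rfl, rfl⟩ hne
          | left _ _ h₁ h₂ h₃ => exact absurd ⟨h₃, h₁, h₂⟩ hL
          | right _ _ h₁ h₂ h₃ => exact absurd ⟨h₃, h₁, h₂⟩ hR

end RealRAM

/-! ### Rotation back and output of a cap -/

/-- The rotation that takes top caps to caps of type `τ`. -/
def CapType.place : CapType → ℝ × ℝ → ℝ × ℝ
  | .top, p => p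
  | .left, p => (-p.2, p.1)
  | .bottom, p => (-p.1, -p.2)
  | .right, p => (p.2, -p.1)

namespace RealRAM

/-- The first coordinate of the rotated point with index `i`. -/
def xE (τ : CapType) (i : IExpr) : RExpr :=
  match τ with
  | .top => .load 4 i
  | .left => .sub (.const 0) (.load 5 i)
  | .bottom => .sub (.const 0) (.load 4 i)
  | .right => .load 5 i

/-- The second coordinate of the rotated point with index `i`. -/
def yE (τ : CapType) (i : IExpr) : RExpr :=
  match τ with
  | .top => .load 5 i
  | .left => .load 4 i
  | .bottom => .sub (.const 0) (.load 5 i)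
  | .right => .sub (.const 0) (.load 4 i)

lemma xE_spec {S W : ℕ} {σ : State} (τ : CapType) {i : IExpr} (hi : i.Ok S W σ)
    (hS : i.val σ < S) : (xE τ i).Ok S W σ ∧ (xE τ i).cost ≤ i.cost + 3 ∧
      (xE τ i).val σ = (τ.place (σ.rmem 4 (i.val σ), σ.rmem 5 (i.val σ))).1 := by
  cases τ <;> simp [xE, RExpr.Ok, RExpr.cost, RExpr.val, CapType.place, hi, hS] <;> omega

lemma yE_spec {S W : ℕ} {σ : State} (τ : CapType) {i : IExpr} (hi : i.Ok S W σ)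
    (hS : i.val σ < S) : (yE τ i).Ok S W σ ∧ (yE τ i).cost ≤ i.cost + 3 ∧
      (yE τ i).val σ = (τ.place (σ.rmem 4 (i.val σ), σ.rmem 5 (i.val σ))).2 := by
  cases τ <;> simp [yE, RExpr.Ok, RExpr.cost, RExpr.val, CapType.place, hi, hS] <;> omega

/-- Write the rotated point with index in register `r` to cell `i` of the output. -/
def writePoint (τ : CapType) (i : IExpr) (r : ℕ) : Program :=
  .seq (.storeR 2 i (xE τ (.reg r))) (.storeR 3 i (yE τ (.reg r)))

/-- The state after writing the point `p` to cell `i` of the output. -/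
def State.write (σ : State) (i : ℕ) (p : ℝ × ℝ) : State :=
  { σ with
    rmem := Function.update (Function.update σ.rmem 2 (Function.update (σ.rmem 2) i p.1)) 3
      (Function.update (σ.rmem 3) i p.2) }

lemma writePoint_spec {S W r : ℕ} {σ : State} {τ : CapType} {i : IExpr} (hi : i.Ok S W σ)
    (hS : i.val σ < S) (hi' : ∀ ρ : State, ρ.ireg = σ.ireg → ρ.imem = σ.imem →
      i.Ok S W ρ ∧ i.val ρ = i.val σ) (hr : σ.ireg r < S) (hrW : σ.ireg r ≤ W) :
    wp S W (writePoint τ i r) (fun ρ t => t ≤ 2 * i.cost + 10 ∧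
      ρ = σ.write (i.val σ) (τ.place (σ.rmem 4 (σ.ireg r), σ.rmem 5 (σ.ireg r)))) σ := by
  obtain ⟨hx, hxc, hxv⟩ := xE_spec (S := S) (W := W) (σ := σ) τ (i := .reg r) hrW hr
  rw [writePoint, wp_seq, wp_storeR]
  refine ⟨hi, hS, hx, ?_⟩
  rw [wp_storeR]
  set σ₁ : State := { σ with rmem := Function.update σ.rmem 2 (Function.update (σ.rmem 2)
    (i.val σ) ((xE τ (.reg r)).val σ)) } with hσ₁
  obtain ⟨hok, hval⟩ := hi' σ₁ rfl rfl
  obtain ⟨hy, hyc, hyv⟩ := yE_spec (S := S) (W := W) (σ := σ₁) τ (i := .reg r) hrW hr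
  refine ⟨hok, by omega, hy, ?_, ?_⟩
  · simp only [IExpr.cost] at hxc hyc
    omega
  · rw [hyv, hval]
    simp [hσ₁, State.write, hxv, IExpr.val]

/-- Write the cap whose end edges are given by the registers `11`, `12`, `13`, `14` and whose size
is in register `15` to the output, from the cell in register `16` on. -/
def backtrack (τ : CapType) : Program :=
  .loop (.ltI (.const 0) (.reg 15))
    (.seq (.setI 17 (.load 1 (codeE 11 12 13 14)))
      (.seq (.setI 15 (.sub (.reg 15) (.const 1)))
        (.cond (.ltR (.load 5 (.reg 11)) (.load 5 (.reg 12)))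
          (.seq (writePoint τ (.reg 16) 11)
            (.seq (.setI 11 (.reg 13)) (.seq (.setI 13 (.reg 17))
              (.setI 16 (.add (.reg 16) (.const 1))))))
          (.seq (writePoint τ (.add (.reg 16) (.reg 15)) 12)
            (.seq (.setI 12 (.reg 14)) (.setI 14 (.reg 17)))))))

/-- The cells of the output from `lo` on hold the rotated points with indices in `Q`. -/
def Written (τ : CapType) (u v : ℕ → ℝ) (lo : ℕ) (Q : List ℕ) (σ : State) : Prop :=
  ∀ i (h : i < Q.length), (σ.rmem 2 (lo + i), σ.rmem 3 (lo + i)) = τ.place (u Q[i], v Q[i])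

/-- The cap fills the cells from `lo` to `lo + m - 1` from both ends inwards: a left end goes to the
first free cell, a right end to the last. After the peak has been written the end registers are
meaningless, so the hypotheses and the conclusion about them are guarded by `0 < m`. -/
lemma backtrack_spec {S W N K : ℕ} {u v : ℕ → ℝ} {I : ℕ → ℕ → ℕ} {τ : CapType}
    (hS : N ^ 4 ≤ S) (hW : N ^ 4 + 1 ≤ W)
    (hsort : ∀ k l, k < N → l < N → v l < v k → k < l)
    (hT : Table u v N (I 0) (I 1) K) (m : ℕ) :
    ∀ (σ : State) (a b c d lo : ℕ), σ.ireg 2 = N → σ.rmem 4 = u → σ.rmem 5 = v → σ.imem = I →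
      σ.ireg 15 = m → σ.ireg 16 = lo → lo + m ≤ S → lo + m ≤ W →
      (0 < m → σ.ireg 11 = a ∧ σ.ireg 12 = c ∧ σ.ireg 13 = b ∧ σ.ireg 14 = d ∧
        a < N ∧ b < N ∧ c < N ∧ d < N ∧ code N a c b d < K ∧ I 0 (code N a c b d) = m) →
      wp S W (backtrack τ) (fun ρ t => t ≤ 200 * m + 10 ∧ (∀ r < 11, ρ.ireg r = σ.ireg r) ∧
        ρ.imem = σ.imem ∧ (∀ j, j ≠ 2 → j ≠ 3 → ρ.rmem j = σ.rmem j) ∧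
        (∀ j, j < lo ∨ lo + m ≤ j → ρ.rmem 2 j = σ.rmem 2 j ∧ ρ.rmem 3 j = σ.rmem 3 j) ∧
        ∃ Q : List ℕ, Q.length = m ∧ (0 < m → Reach u v N a b c d Q) ∧ Written τ u v lo Q ρ)
        σ := by
  have hN4 : N ≤ N ^ 4 := Nat.le_self_pow (by norm_num) N
  induction m with
  | zero =>
    intro σ a b c d lo h2 h4 h5 hI h15 h16 hloS hloW h
    rw [backtrack, wp_loop]
    refine ⟨by simp [Test.Ok, IExpr.Ok, h15], fun hh => ?_, fun _ => ?_⟩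
    · simp [Test.Holds, IExpr.val, h15] at hh
    · simp [Test.cost, IExpr.cost, Written]
  | succ m ih =>
    intro σ a b c d lo h2 h4 h5 hI h15 h16 hloS hloW h
    obtain ⟨h11, h12, h13, h14, ha, hb, hc, hd, hK, hm⟩ := h (by omega)
    obtain ⟨-, hP, hE⟩ := hT a b c d ha hb hc hd hK
    obtain ⟨hstep, Q₀, hQ₀, -⟩ := hE (by omega)
    have hcode := (code_bound ha hb hc hd).2.2.2.2.2
    rw [backtrack, wp_loop]
    refine ⟨by simp [Test.Ok, IExpr.Ok, h15]; omega, fun _ => ?_, fun hh => ?_⟩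
    swap
    · simp [Test.Holds, IExpr.val, h15] at hh
    obtain ⟨hok, hval⟩ := codeE_spec (S := S) (ra := 11) (rc := 12) (rb := 13) (rd := 14) h2
      (show N ^ 4 ≤ W by omega) (by omega) (by omega) (by omega) (by omega)
    rw [h11, h12, h13, h14] at hval
    rw [wp_seq, wp_setI]
    refine ⟨?_, ?_⟩
    · simp only [IExpr.Ok, hok, hval, hI, true_and]
      omega
    simp only [IExpr.val, hval, hI]
    rw [wp_seq, wp_setI]
    refine ⟨by simp [IExpr.Ok, h15]; omega, ?_⟩
    simp only [IExpr.val]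
    generalize hp : I 1 (code N a c b d) = p at *
    have hσ : ∃ σ₁ : State, σ₁ = { σ with
      ireg := Function.update (Function.update σ.ireg 17 p) 15
        (Function.update σ.ireg 17 p 15 - 1) } := ⟨_, rfl⟩
    obtain ⟨σ₁, hσ₁⟩ := hσ
    rw [show State.mk (Function.update (Function.update σ.ireg 17 p) 15
      (Function.update σ.ireg 17 p 15 - 1)) σ.rreg I σ.rmem = σ₁ by rw [hσ₁, ← hI]]
    have r : ∀ r, r ≠ 15 → r ≠ 17 → σ₁.ireg r = σ.ireg r := by
      intro r h₁ h₂
      simp [hσ₁, h₁, h₂]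
    have s2 := (r 2 (by simp) (by simp)).trans h2
    have s11 := (r 11 (by simp) (by simp)).trans h11
    have s12 := (r 12 (by simp) (by simp)).trans h12
    have s13 := (r 13 (by simp) (by simp)).trans h13
    have s14 := (r 14 (by simp) (by simp)).trans h14
    have s16 := (r 16 (by simp) (by simp)).trans h16
    have s15 : σ₁.ireg 15 = m := by simp [hσ₁, h15]
    have s17 : σ₁.ireg 17 = p := by simp [hσ₁]
    have m4 : σ₁.rmem 4 = u := by simp [hσ₁, h4]
    have m5 : σ₁.rmem 5 = v := by simp [hσ₁, h5]
    have mI : σ₁.imem = I := by simp [hσ₁, hI]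
    have mr : σ₁.rmem = σ.rmem := by simp [hσ₁]
    clear hσ₁
    rw [wp_cond]
    refine ⟨by simp [Test.Ok, RExpr.Ok, IExpr.Ok, IExpr.val, s11, s12]; omega,
      fun hh => ?_, fun hh => ?_⟩
    · simp only [Test.Holds, RExpr.val, IExpr.val, m5, s11, s12] at hh
      have hl : u a < u b ∧ v a < v b ∧ (p = b ∨ turn u v a b p < 0) ∧
          0 < I 0 (code N b c p d) ∧ I 0 (code N a c b d) = I 0 (code N b c p d) + 1 := by
        rcases hstep with ⟨rfl, rfl, rfl, _⟩ | ⟨_, h⟩ | ⟨h, _⟩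
        · exact absurd hh (lt_irrefl _)
        · rwa [hp] at h
        · exact absurd hh h.not_gt
      obtain ⟨l₁, l₂, l₃, l₄, l₅⟩ := hl
      rw [wp_seq]
      refine (writePoint_spec (by simp [IExpr.Ok, s16]; omega) (by simp [IExpr.val, s16]; omega)
        ?_ (by omega) (by omega)).mono ?_
      · intro ρ h₁ _
        simp [IExpr.Ok, IExpr.val, h₁, s16]
        omega
      rintro ρ t ⟨ht, rfl⟩
      rw [wp_seq, wp_setI]
      refine ⟨by simp [IExpr.Ok, State.write, s13]; omega, ?_⟩
      rw [wp_seq, wp_setI]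
      refine ⟨by simp [IExpr.Ok, State.write, s17]; omega, ?_⟩
      rw [wp_setI]
      refine ⟨by simp [IExpr.Ok, IExpr.val, State.write, s16]; omega, ?_⟩
      simp only [IExpr.val, State.write, s11, s13, s16, m4, m5]
      refine (ih _ b p c d (lo + 1) ?_ ?_ ?_ ?_ ?_ ?_ (by omega) (by omega) ?_).mono ?_
      · simpa using s2
      · simpa using m4
      · simpa using m5
      · exact mI
      · simpa using s15
      · simp [s16]
      · intro _
        have := code_lt_left hc hd hP (hsort b a hb ha l₂)
        refine ⟨?_, ?_, ?_, ?_, hb, hP, hc, hd, by omega, by omega⟩ <;>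
          simp [s12, s14, s17]
      · rintro ρ t' ⟨ht', hr, hi, hm', hj, Q, hQ, hQr, hw⟩
        refine ⟨?_, ?_, ?_, ?_, ?_, a :: Q, by simp [hQ], fun _ => ?_, ?_⟩
        · simp only [Test.cost, RExpr.cost, IExpr.cost, codeE] at ht ⊢
          omega
        · intro q hq
          rw [hr q hq]
          simp only [Function.update_apply]
          rw [if_neg (by omega), if_neg (by omega), if_neg (by omega), r q (by omega) (by omega)]
        · exact hi.trans mI
        · intro j h₂ h₃
          rw [hm' j h₂ h₃]
          simp [h₂, h₃, mr]
        · intro j hj'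
          obtain ⟨e₁, e₂⟩ := hj j (by omega)
          rw [e₁, e₂]
          simp [mr, show j ≠ lo by omega]
        · rcases Nat.eq_zero_or_pos m with rfl | hm0
          · omega
          · exact .left (hQr hm0) ha l₁ l₂ hh l₃
        · intro i hi
          rcases i with _ | i
          · obtain ⟨e₁, e₂⟩ := hj lo (by omega)
            simp only [add_zero, List.getElem_cons_zero]
            rw [e₁, e₂]
            simp
          · have := hw i (by simpa using hi)
            rw [show lo + (i + 1) = lo + 1 + i by omega]
            simpa using this
    · simp only [Test.Holds, RExpr.val, IExpr.val, m5, s11, s12] at hh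
      -- The peak also takes this branch, since `v a < v c` fails for it. It is recognized by `m =
      -- 0` remaining vertices, and then the first and the last free cell coincide.
      have hl : (a = b ∧ b = c ∧ c = d ∧ m = 0) ∨ (0 < m ∧ v c < v a ∧ u d < u c ∧ v c < v d ∧
          (p = d ∨ turn u v p d c < 0) ∧
          I 0 (code N a c b d) = I 0 (code N a d b p) + 1) := by
        rcases hstep with ⟨h₁, h₂, h₃, h₄⟩ | ⟨h, _⟩ | ⟨h, h'⟩
        · exact Or.inl ⟨h₁, h₂, h₃, by omega⟩
        · exact absurd h hh
        · rw [hp] at h'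
          exact Or.inr ⟨by omega, h, h'.1, h'.2.1, h'.2.2.1, h'.2.2.2.2⟩
      rw [wp_seq]
      refine (writePoint_spec (by simp [IExpr.Ok, IExpr.val, s15, s16]; omega)
        (by simp [IExpr.val, s15, s16]; omega) ?_ (by omega) (by omega)).mono ?_
      · intro ρ h₁ _
        simp [IExpr.Ok, IExpr.val, h₁, s15, s16]
        omega
      rintro ρ t ⟨ht, rfl⟩
      rw [wp_seq, wp_setI]
      refine ⟨by simp [IExpr.Ok, State.write, s14]; omega, ?_⟩
      rw [wp_setI]
      refine ⟨by simp [IExpr.Ok, State.write, s17]; omega, ?_⟩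
      simp only [IExpr.val, State.write, s12, s14, s15, s16, m4, m5]
      refine (ih _ a b d p lo ?_ ?_ ?_ ?_ ?_ ?_ (by omega) (by omega) ?_).mono ?_
      · simpa using s2
      · simpa using m4
      · simpa using m5
      · exact mI
      · simpa using s15
      · simp [s16]
      · intro hm0
        rcases hl with h | ⟨_, l₀, l₁, l₂, l₃, l₄⟩
        · omega
        have := code_lt_right hb hP (a := a) (hsort d c hd hc l₂)
        refine ⟨?_, ?_, ?_, ?_, ha, hb, hd, hP, by omega, by omega⟩ <;>
          simp [s11, s13, s17]
      · rintro ρ t' ⟨ht', hr, hi, hm', hj, Q, hQ, hQr, hw⟩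
        refine ⟨?_, ?_, ?_, ?_, ?_, Q ++ [c], by simp [hQ], fun _ => ?_, ?_⟩
        · simp only [Test.cost, RExpr.cost, IExpr.cost, codeE] at ht ⊢
          omega
        · intro q hq
          rw [hr q hq]
          simp only [Function.update_apply]
          rw [if_neg (by omega), if_neg (by omega), r q (by omega) (by omega)]
        · exact hi.trans mI
        · intro j h₂ h₃
          rw [hm' j h₂ h₃]
          simp [h₂, h₃, mr]
        · intro j hj'
          obtain ⟨e₁, e₂⟩ := hj j (by omega)
          rw [e₁, e₂]
          simp [mr, show j ≠ lo + m by omega]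
        · rcases hl with ⟨rfl, rfl, rfl, rfl⟩ | ⟨hm0, l₀, l₁, l₂, l₃, l₄⟩
          · rw [List.length_eq_zero_iff.1 hQ]
            exact .peak ha
          · exact .right (hQr hm0) hc l₁ l₂ l₀ l₃
        · intro i hi
          rcases Nat.lt_or_ge i Q.length with hi' | hi'
          · rw [List.getElem_append_left hi']
            exact hw i hi'
          · obtain rfl : i = m := by simp at hi; omega
            obtain ⟨e₁, e₂⟩ := hj (lo + i) (by omega)
            rw [e₁, e₂]
            simp [hQ]

end RealRAM

/-! ### Filling the table -/

namespace RealRAM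

/-- Replace the output by the cap of the current table entry. -/
def record (τ : CapType) : Program :=
  .seq (.setI 11 (.reg 3)) (.seq (.setI 12 (.reg 4)) (.seq (.setI 13 (.reg 5))
    (.seq (.setI 14 (.reg 6)) (.seq (.setI 15 (.reg 9)) (.seq (.setI 16 (.const 0))
      (.seq (.setI 0 (.reg 9)) (backtrack τ)))))))

/-- Compute a table entry, store it, and improve the output if possible. -/
def body (τ : CapType) : Program :=
  .seq compute (.seq (.storeI 0 (.reg 7) (.reg 9)) (.seq (.storeI 1 (.reg 7) (.reg 10))
    (.seq (.cond (.ltI (.reg 0) (.reg 9)) (record τ) .skip)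
      (.setI 7 (.add (.reg 7) (.const 1))))))

/-- Fill the table. -/
def fillTable (τ : CapType) : Program :=
  .seq (.setI 7 (.const 0)) (.forBelow 3 2 (.forBelow 4 2 (.forBelow 5 2 (.forBelow 6 2 (body τ)))))

/-- The resources and the indexing of the points that the dynamic program relies on. -/
structure Setting (S W n N : ℕ) (u v : ℕ → ℝ) : Prop where
  one_le : 1 ≤ N
  n_le : n ≤ N
  space : N ^ 4 ≤ S
  word : N ^ 4 + n + 1 ≤ W
  sort : ∀ k l, k < N → l < N → v l < v k → k < l
  length_le : ∀ a b c d Q, Reach u v N a b c d Q → Q.length ≤ n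

/-- The invariant of the dynamic program after `K` table entries: the output has the property `G`
and is at least as long as all table entries and as `L`. -/
structure Inv (n N : ℕ) (u v x y : ℕ → ℝ) (G : List (ℝ × ℝ) → Prop) (L K : ℕ) (σ : State) :
    Prop where
  reg1 : σ.ireg 1 = n
  reg2 : σ.ireg 2 = N
  reg7 : σ.ireg 7 = K
  mem0 : σ.rmem 0 = x
  mem1 : σ.rmem 1 = y
  mem4 : σ.rmem 4 = u
  mem5 : σ.rmem 5 = v
  table : Table u v N (σ.imem 0) (σ.imem 1) K
  good : G (output σ)
  le_length : L ≤ σ.ireg 0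
  length_le : σ.ireg 0 ≤ n
  max : ∀ k < K, σ.imem 0 k ≤ σ.ireg 0

lemma good_of_output_congr {σ ρ : State} {G : List (ℝ × ℝ) → Prop} (h : G (output σ))
    (h₀ : ρ.ireg 0 = σ.ireg 0) (h₂ : ρ.rmem 2 = σ.rmem 2) (h₃ : ρ.rmem 3 = σ.rmem 3) :
    G (output ρ) := by
  simpa [output, h₀, h₂, h₃] using h

lemma output_eq_of_written {τ : CapType} {u v : ℕ → ℝ} {Q : List ℕ} {σ : State}
    (h : Written τ u v 0 Q σ) (hQ : σ.ireg 0 = Q.length) :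
    output σ = Q.map fun i => τ.place (u i, v i) := by
  refine List.ext_getElem (by simp [output, hQ]) fun i h₁ h₂ => ?_
  have := h i (by simpa using h₂)
  simpa [output] using this

lemma Inv.update {n N L K r : ℕ} {u v x y : ℕ → ℝ} {G : List (ℝ × ℝ) → Prop} {σ : State}
    (h : Inv n N u v x y G L K σ) (hr : r = 3 ∨ r = 4 ∨ r = 5 ∨ r = 6) (z : ℕ) :
    Inv n N u v x y G L K { σ with ireg := Function.update σ.ireg r z } := by
  obtain ⟨h1, h2, h3, h4, h5, h6, h7, h8, h9, h10, h11, h12⟩ := h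
  have e : ∀ s, s = 0 ∨ s = 1 ∨ s = 2 ∨ s = 7 → Function.update σ.ireg r z s = σ.ireg s :=
    fun s hs => Function.update_of_ne (by omega) _ _
  constructor
  · simpa [e] using h1
  · simpa [e] using h2
  · simpa [e] using h3
  · exact h4
  · exact h5
  · exact h6
  · exact h7
  · exact h8
  · exact good_of_output_congr h9 (by simp [e]) rfl rfl
  · simpa [e] using h10
  · simpa [e] using h11
  · simpa [e] using h12

/-- The guard `0 < σ.ireg 9` ensures that the entry belongs to an actual cap. Earlier output cells
need no clearing, because register `0` delimits the output. -/
lemma record_spec {S W n N K a b c d : ℕ} {u v : ℕ → ℝ} {τ : CapType} {σ : State}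
    (hs : Setting S W n N u v) (hT : Table u v N (σ.imem 0) (σ.imem 1) K)
    (h2 : σ.ireg 2 = N) (h3 : σ.ireg 3 = a) (h4 : σ.ireg 4 = c) (h5 : σ.ireg 5 = b)
    (h6 : σ.ireg 6 = d) (hu : σ.rmem 4 = u) (hv : σ.rmem 5 = v) (ha : a < N) (hb : b < N)
    (hc : c < N) (hd : d < N) (hK : code N a c b d < K) (hf : σ.ireg 9 ≤ n)
    (h9 : σ.imem 0 (code N a c b d) = σ.ireg 9) (hpos : 0 < σ.ireg 9) :
    wp S W (record τ) (fun ρ t => t ≤ 200 * n + 30 ∧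
      (∀ r, r ≠ 0 → r < 11 → ρ.ireg r = σ.ireg r) ∧ ρ.imem = σ.imem ∧
      (∀ j, j ≠ 2 → j ≠ 3 → ρ.rmem j = σ.rmem j) ∧ ρ.ireg 0 = σ.ireg 9 ∧
      ∃ Q, Reach u v N a b c d Q ∧ output ρ = Q.map fun i => τ.place (u i, v i)) σ := by
  have hN4 : N ≤ N ^ 4 := Nat.le_self_pow (by norm_num) N
  have hw := hs.word
  have hsp := hs.space
  have hn := hs.n_le
  simp only [record, wp_seq, wp_setI, IExpr.Ok, IExpr.val, IExpr.cost]
  simp only [ne_eq, Function.update_of_ne, not_false_eq_true, Nat.reduceEqDiff, h3, h4, h5, h6]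
  refine ⟨by omega, by omega, by omega, by omega, by omega, by omega, by omega, ?_⟩
  refine (backtrack_spec (W := W) (τ := τ) (K := K) (I := σ.imem) hs.space (by omega) hs.sort hT (σ.ireg 9) _
    a b c d 0 ?_ ?_ ?_ ?_ ?_ ?_ (by omega) (by omega) ?_).mono ?_
  · simpa using h2
  · exact hu
  · exact hv
  · rfl
  · simp
  · simp
  · intro _
    simpa using ⟨ha, hb, hc, hd, hK, h9⟩
  · rintro ρ t ⟨ht, hr, hi, hm, -, Q, hQ, hQr, hw⟩
    have h0 : ρ.ireg 0 = σ.ireg 9 := by simpa using hr 0 (by norm_num)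
    refine ⟨by omega, fun r h₁ h₂ => ?_, hi, hm, h0, Q, hQr hpos,
      output_eq_of_written hw (by omega)⟩
    rw [hr r h₂]
    simp only [Function.update_apply]
    rw [if_neg (by omega), if_neg (by omega), if_neg (by omega), if_neg (by omega),
      if_neg (by omega), if_neg (by omega), if_neg (by omega)]

/-- The search costs at most `15000 * N + 100`. Rewriting the output costs at most `200 * n + 30`
with `n ≤ N`, so it fits into the same linear bound. -/
lemma body_spec {S W n N L a b c d : ℕ} {u v x y : ℕ → ℝ} {G : List (ℝ × ℝ) → Prop}
    {τ : CapType} {σ : State} (hs : Setting S W n N u v)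
    (hG : ∀ a b c d Q, Reach u v N a b c d Q → G (Q.map fun i => τ.place (u i, v i)))
    (h3 : σ.ireg 3 = a) (h4 : σ.ireg 4 = c) (h5 : σ.ireg 5 = b) (h6 : σ.ireg 6 = d)
    (ha : a < N) (hb : b < N) (hc : c < N) (hd : d < N)
    (hI : Inv n N u v x y G L (code N a c b d) σ) :
    wp S W (body τ) (fun ρ t => t ≤ 16000 * N ∧
      ρ.ireg 3 = a ∧ ρ.ireg 4 = c ∧ ρ.ireg 5 = b ∧ ρ.ireg 6 = d ∧
      Inv n N u v x y G L (code N a c b d + 1) ρ) σ := by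
  have hN4 : N ≤ N ^ 4 := Nat.le_self_pow (by norm_num) N
  have hcode := (code_bound ha hb hc hd).2.2.2.2.2
  have hw := hs.word
  have hsp := hs.space
  have hn := hs.n_le
  have hN1 := hs.one_le
  rw [body, wp_seq]
  refine (compute_spec hs.sort hs.one_le hs.space (by omega) hI.reg2 h3 h4 h5 h6 ha hb hc hd
    hI.mem4 hI.mem5 hI.table (fun k hk => ?_)).mono ?_
  · have := hI.max k hk
    have := hI.length_le
    omega
  rintro σ₁ t ⟨ht, ⟨hr, hi, hm⟩, hp, hmax, hf⟩
  have r0 : σ₁.ireg 0 = σ.ireg 0 := hr 0 (by simp) (by simp) (by simp)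
  have r7 : σ₁.ireg 7 = code N a c b d := (hr 7 (by simp) (by simp) (by simp)).trans hI.reg7
  generalize hK : code N a c b d = K at *
  generalize hfe : σ₁.ireg 9 = f at *
  generalize hpe : σ₁.ireg 10 = p at *
  -- A positive value is attained: extend a cap that attains the predecessor entry.
  have hex : 0 < f → ∃ Q, Reach u v N a b c d Q ∧ Q.length = f := by
    intro h
    rcases hf h with ⟨rfl, rfl, rfl, rfl⟩ | ⟨k₁, k₂, k₃, k₄, k₅, k₆⟩ | ⟨k₁, k₂, k₃, k₄, k₅, k₆⟩
    · exact ⟨[a], .peak ha, rfl⟩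
    · have hlt : code N b c p d < K := hK ▸ code_lt_left hc hd hp (hs.sort b a hb ha k₃)
      obtain ⟨-, Q, hQ, hQl⟩ := (hI.table b p c d hb hp hc hd hlt).2.2 k₅
      exact ⟨a :: Q, .left hQ ha k₂ k₃ k₁ k₄, by simp [hQl, k₆]⟩
    · have hlt : code N a d b p < K := hK ▸ code_lt_right hb hp (hs.sort d c hd hc k₃)
      obtain ⟨-, Q, hQ, hQl⟩ := (hI.table a b d p ha hb hd hp hlt).2.2 k₅
      exact ⟨Q ++ [c], .right hQ hc k₂ k₃ k₁ k₄, by simp [hQl, k₆]⟩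
  have hfn : f ≤ n := by
    rcases Nat.eq_zero_or_pos f with h | h
    · omega
    · obtain ⟨Q, hQ, rfl⟩ := hex h
      exact hs.length_le _ _ _ _ _ hQ
  rw [wp_seq, wp_storeI]
  refine ⟨by simp [IExpr.Ok]; omega, by simp [IExpr.val]; omega, by simp [IExpr.Ok]; omega, ?_⟩
  rw [wp_seq, wp_storeI]
  refine ⟨by simp [IExpr.Ok]; omega, by simp [IExpr.val]; omega, by simp [IExpr.Ok]; omega, ?_⟩
  simp only [IExpr.val, r7, hfe, hpe]
  obtain ⟨σ₂, hσ₂⟩ : ∃ σ₂ : State, σ₂ = { σ₁ with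
    imem := Function.update (Function.update σ₁.imem 0 (Function.update (σ₁.imem 0) K f)) 1
      (Function.update (Function.update σ₁.imem 0 (Function.update (σ₁.imem 0) K f) 1) K p) } :=
    ⟨_, rfl⟩
  rw [← hσ₂]
  have s : ∀ r, σ₂.ireg r = σ₁.ireg r := fun r => by rw [hσ₂]
  have sm : σ₂.rmem = σ.rmem := by rw [hσ₂]; exact hm
  have s0 : σ₂.imem 0 = Function.update (σ.imem 0) K f := by simp [hσ₂, hi]
  have s1 : σ₂.imem 1 = Function.update (σ.imem 1) K p := by simp [hσ₂, hi]
  clear hσ₂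
  -- Entries refer only to entries of smaller address, so writing cell `K` does not disturb those
  -- already verified.
  have hT : Table u v N (σ₂.imem 0) (σ₂.imem 1) (K + 1) := by
    have hne : ∀ k < K, σ₂.imem 0 k = σ.imem 0 k ∧ σ₂.imem 1 k = σ.imem 1 k := by
      intro k hk
      rw [s0, s1, Function.update_of_ne hk.ne, Function.update_of_ne hk.ne]
      exact ⟨rfl, rfl⟩
    intro a' b' c' d' ha' hb' hc' hd' hlt
    rcases Nat.lt_succ_iff_lt_or_eq.1 hlt with hlt | heq
    · obtain ⟨e₁, e₂, e₃⟩ := hI.table a' b' c' d' ha' hb' hc' hd' hlt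
      obtain ⟨g₁, g₂⟩ := hne _ hlt
      refine ⟨by rwa [g₁], by rwa [g₂], ?_⟩
      rw [g₁]
      intro hpos
      obtain ⟨st, ex⟩ := e₃ hpos
      refine ⟨?_, ex⟩
      unfold Step at st ⊢
      rw [g₁, g₂]
      rcases st with h | h | h
      · exact Or.inl h
      · have := code_lt_left hc' hd' e₂ (hs.sort b' a' hb' ha' h.2.2.1)
        rw [(hne _ (this.trans hlt)).1]
        exact Or.inr (Or.inl h)
      · have := code_lt_right hb' e₂ (a := a') (hs.sort d' c' hd' hc' h.2.2.1)
        rw [(hne _ (this.trans hlt)).1]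
        exact Or.inr (Or.inr h)
    · obtain ⟨rfl, rfl, rfl, rfl⟩ := code_inj hb' hc' hd' hb hc hd (heq.trans hK.symm)
      have g₁ : σ₂.imem 0 K = f := by simp [s0]
      have g₂ : σ₂.imem 1 K = p := by simp [s1]
      refine ⟨by rwa [hK, g₁], by rwa [hK, g₂], ?_⟩
      rw [hK, g₁]
      refine fun hpos => ⟨?_, hex hpos⟩
      unfold Step
      rw [hK, g₁, g₂]
      rcases hf hpos with h | h | h
      · exact Or.inl h
      · have := code_lt_left hc hd hp (hs.sort _ _ hb ha h.2.2.1)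
        rw [hK] at this
        rw [(hne _ this).1]
        exact Or.inr (Or.inl h)
      · have := code_lt_right hb hp (a := a') (hs.sort _ _ hd hc h.2.2.1)
        rw [hK] at this
        rw [(hne _ this).1]
        exact Or.inr (Or.inr h)
  have t1 : σ₂.ireg 1 = n := by rw [s, hr 1 (by simp) (by simp) (by simp), hI.reg1]
  have t2 : σ₂.ireg 2 = N := by rw [s, hr 2 (by simp) (by simp) (by simp), hI.reg2]
  have t3 : σ₂.ireg 3 = a := by rw [s, hr 3 (by simp) (by simp) (by simp), h3]
  have t4 : σ₂.ireg 4 = c := by rw [s, hr 4 (by simp) (by simp) (by simp), h4]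
  have t5 : σ₂.ireg 5 = b := by rw [s, hr 5 (by simp) (by simp) (by simp), h5]
  have t6 : σ₂.ireg 6 = d := by rw [s, hr 6 (by simp) (by simp) (by simp), h6]
  have t7 : σ₂.ireg 7 = K := by rw [s, r7]
  have t0 : σ₂.ireg 0 = σ.ireg 0 := by rw [s, r0]
  have t9 : σ₂.ireg 9 = f := by rw [s, hfe]
  have hLn := hI.length_le
  have hL := hI.le_length
  have hmaxK : ∀ z, σ.ireg 0 ≤ z → f ≤ z → ∀ k < K + 1, σ₂.imem 0 k ≤ z := by
    intro z h₁ h₂ k hk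
    rw [s0]
    rcases Nat.lt_succ_iff_lt_or_eq.1 hk with hk | rfl
    · rw [Function.update_of_ne hk.ne]
      exact (hI.max k hk).trans h₁
    · simpa using h₂
  rw [wp_seq, wp_cond]
  refine ⟨by simp [Test.Ok, IExpr.Ok]; omega, fun hh => ?_, fun hh => ?_⟩
  · simp only [Test.Holds, IExpr.val, t0, t9] at hh
    refine (record_spec hs hT t2 t3 t4 t5 t6 (by rw [sm, hI.mem4]) (by rw [sm, hI.mem5]) ha hb hc
      hd (by omega) (by omega) (by simp [hK, s0, t9]) (by omega)).mono ?_
    rintro ρ t' ⟨ht', hr', hi', hm', h0', Q, hQ, hout⟩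
    rw [wp_setI]
    have q7 := (hr' 7 (by simp) (by simp)).trans t7
    refine ⟨by simp [IExpr.Ok, IExpr.val, q7]; omega, ?_, ?_, ?_, ?_, ?_, ?_⟩
    · simp only [Test.cost, IExpr.cost]
      omega
    · simpa [t3] using hr' 3 (by simp) (by simp)
    · simpa [t4] using hr' 4 (by simp) (by simp)
    · simpa [t5] using hr' 5 (by simp) (by simp)
    · simpa [t6] using hr' 6 (by simp) (by simp)
    · constructor
      · simpa [t1] using hr' 1 (by simp) (by simp)
      · simpa [t2] using hr' 2 (by simp) (by simp)
      · simp [IExpr.val, q7]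
      · simpa [sm, hI.mem0] using hm' 0 (by simp) (by simp)
      · simpa [sm, hI.mem1] using hm' 1 (by simp) (by simp)
      · simpa [sm, hI.mem4] using hm' 4 (by simp) (by simp)
      · simpa [sm, hI.mem5] using hm' 5 (by simp) (by simp)
      · simpa [hi'] using hT
      · exact good_of_output_congr (σ := ρ) (hout ▸ hG _ _ _ _ _ hQ) (by simp) rfl rfl
      · simp
        omega
      · simp
        omega
      · simp only [hi']
        refine hmaxK _ ?_ ?_ <;> simp <;> omega
  · simp only [Test.Holds, IExpr.val, t0, t9] at hh
    rw [wp_skip, wp_setI]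
    refine ⟨by simp [IExpr.Ok, IExpr.val, t7]; omega, ?_, ?_, ?_, ?_, ?_, ?_⟩
    · simp only [Test.cost, IExpr.cost]
      omega
    · simpa using t3
    · simpa using t4
    · simpa using t5
    · simpa using t6
    · constructor
      · simpa using t1
      · simpa using t2
      · simp [IExpr.val, t7]
      · simp [sm, hI.mem0]
      · simp [sm, hI.mem1]
      · simp [sm, hI.mem4]
      · simp [sm, hI.mem5]
      · exact hT
      · exact good_of_output_congr hI.good (by simpa using t0) (by simp [sm]) (by simp [sm])
      · simp
        omega
      · simp
        omega
      · refine hmaxK _ ?_ ?_ <;> simp <;> omega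

/-- The four loop counters are the digits of the address, so register `7` runs through all addresses
in increasing order. The table invariant is vacuous at the start; values left over from another cap
type do no harm. -/
lemma fillTable_spec {S W n N L : ℕ} {u v x y : ℕ → ℝ} {G : List (ℝ × ℝ) → Prop}
    {τ : CapType} {σ : State} (hs : Setting S W n N u v)
    (hG : ∀ a b c d Q, Reach u v N a b c d Q → G (Q.map fun i => τ.place (u i, v i)))
    (h1 : σ.ireg 1 = n) (h2 : σ.ireg 2 = N) (hx : σ.rmem 0 = x) (hy : σ.rmem 1 = y)
    (hu : σ.rmem 4 = u) (hv : σ.rmem 5 = v) (hout : G (output σ)) (hL : σ.ireg 0 = L)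
    (hLn : L ≤ n) :
    wp S W (fillTable τ) (fun ρ t => t ≤ 900000000 * N ^ 5 ∧
      Inv n N u v x y G L (N ^ 4) ρ) σ := by
  have hN4 : N ≤ N ^ 4 := Nat.le_self_pow (by norm_num) N
  have hw := hs.word
  have hN1 := hs.one_le
  have hN0 : 0 < N := hN1
  have hNW : N + 1 ≤ W := by omega
  rw [fillTable, wp_seq, wp_setI]
  refine ⟨by simp [IExpr.Ok], ?_⟩
  have hI : Inv n N u v x y G L 0 { σ with ireg := Function.update σ.ireg 7 0 } := by
    constructor
    · simpa using h1
    · simpa using h2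
    · simp
    · exact hx
    · exact hy
    · exact hu
    · exact hv
    · exact fun _ _ _ _ _ _ _ _ h => absurd h (Nat.not_lt_zero _)
    · exact good_of_output_congr hout (by simp) rfl rfl
    · simp [hL]
    · simpa [hL] using hLn
    · exact fun _ h => absurd h (Nat.not_lt_zero _)
  refine (wp_forBelow (I := fun a ρ => Inv n N u v x y G L (code N a 0 0 0) ρ) (M := N)
    (T := 15 * (N * (15 * (N * (15 * (N * (16000 * N))))))) (by norm_num) hN1 hNW
    (by simpa using h2) (Nat.succ_le_of_lt (by positivity)) ?_ ?_).mono ?_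
  · have := hI.update (r := 3) (by simp) 0
    simpa [code, IExpr.val] using this
  · intro a ha σ₁ ra _ hI₁
    refine (wp_forBelow (I := fun c ρ => ρ.ireg 3 = a ∧ Inv n N u v x y G L (code N a c 0 0) ρ)
      (M := N) (T := 15 * (N * (15 * (N * (16000 * N))))) (by norm_num) hN1 hNW hI₁.reg2
      (Nat.succ_le_of_lt (by positivity)) ?_ ?_).mono ?_
    · exact ⟨by simpa using ra, hI₁.update (by simp) _⟩
    · rintro c hc σ₂ rc _ ⟨ra₂, hI₂⟩
      refine (wp_forBelow (I := fun b ρ => ρ.ireg 3 = a ∧ ρ.ireg 4 = c ∧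
        Inv n N u v x y G L (code N a c b 0) ρ) (M := N) (T := 15 * (N * (16000 * N)))
        (by norm_num) hN1 hNW hI₂.reg2 (by nlinarith) ?_ ?_).mono ?_
      · exact ⟨by simpa using ra₂, by simpa using rc, hI₂.update (by simp) _⟩
      · rintro b hb σ₃ rb _ ⟨ra₃, rc₃, hI₃⟩
        refine (wp_forBelow (I := fun d ρ => ρ.ireg 3 = a ∧ ρ.ireg 4 = c ∧ ρ.ireg 5 = b ∧
          Inv n N u v x y G L (code N a c b d) ρ) (M := N) (T := 16000 * N)
          (by norm_num) hN1 hNW hI₃.reg2 (by omega) ?_ ?_).mono ?_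
        · exact ⟨by simpa using ra₃, by simpa using rc₃, by simpa using rb,
            hI₃.update (by simp) _⟩
        · rintro d hd σ₄ rd _ ⟨ra₄, rc₄, rb₄, hI₄⟩
          refine (body_spec hs hG ra₄ rc₄ rb₄ rd ha hb hc hd hI₄).mono ?_
          rintro ρ t ⟨ht, q3, q4, q5, q6, hI'⟩
          exact ⟨ht, q6, hI'.reg2, by simpa using q3, by simpa using q4, by simpa using q5,
            hI'.update (by simp) _⟩
        · rintro ρ t ⟨ht, -, q2, q3, q4, q5, hI'⟩
          refine ⟨ht, q5, q2, by simpa using q3, by simpa using q4, ?_⟩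
          -- A carry: the last digit having reached `N` is the same address as the next digit
          -- increased by one and the last digit `0`.
          have e : code N a c (b + 1) 0 = code N a c b N := by simp only [code]; ring
          rw [e]
          exact hI'.update (by simp) _
      · rintro ρ t ⟨ht, -, q2, q3, q4, hI'⟩
        refine ⟨ht, q4, q2, by simpa using q3, ?_⟩
        have e : code N a (c + 1) 0 0 = code N a c N 0 := by simp only [code]; ring
        rw [e]
        exact hI'.update (by simp) _
    · rintro ρ t ⟨ht, -, q2, q3, hI'⟩
      refine ⟨ht, q3, q2, ?_⟩
      have e : code N (a + 1) 0 0 0 = code N a N 0 0 := by simp only [code]; ring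
      rw [e]
      exact hI'.update (by simp) _
  · rintro ρ t ⟨ht, -, q2, hI'⟩
    refine ⟨?_, ?_⟩
    · have e : 15 * (N * (15 * (N * (15 * (N * (15 * (N * (16000 * N)))))))) =
          810000000 * N ^ 5 := by ring
      have : 1 ≤ N ^ 5 := Nat.one_le_pow _ _ hN1
      simp only [IExpr.cost]
      omega
    · have e : N ^ 4 = code N N 0 0 0 := by simp only [code]; ring
      rwa [e]

end RealRAM

/-! ## Reduction of the four types to top caps -/

/-- The abscissas of the grid after the rotation that takes caps of type `τ` to top caps. -/
def CapType.abscissa (τ : CapType) (x y : ℕ → ℝ) : ℕ → ℝ :=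
  match τ with
  | .top => x
  | .left => y
  | .bottom => -x
  | .right => -y

/-- The ordinates of the grid after the rotation that takes caps of type `τ` to top caps. -/
def CapType.ordinate (τ : CapType) (x y : ℕ → ℝ) : ℕ → ℝ :=
  match τ with
  | .top => y
  | .left => -x
  | .bottom => -y
  | .right => x

lemma orient_place (τ : CapType) (p q r : ℝ × ℝ) :
    orient (τ.place p) (τ.place q) (τ.place r) = orient p q r := by
  cases τ <;> simp only [orient, CapType.place] <;> ring

lemma isConvexPolygon_iff {P : List (ℝ × ℝ)} :
    IsConvexPolygon P ↔ P.Triplewise (fun p q r => orient p q r < 0) := by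
  rw [List.triplewise_iff_getElem]
  exact ⟨fun h i j k hij hjk hk => h ⟨i, by omega⟩ ⟨j, by omega⟩ ⟨k, hk⟩ hij hjk,
    fun h i j k hij hjk => h i j k hij hjk k.2⟩

/-- The rotation preserves orientation and turns increasing abscissas into the monotonicity of type
`τ`. That monotonicity already makes one of the two coordinates injective, so the index form only
has to demand distinct ordinates. -/
lemma isCapList_iff (τ : CapType) {u v : ℕ → ℝ} {Q : List ℕ} :
    IsCapList u v Q ↔ IsConvexCapOfType τ (Q.map fun i => τ.place (u i, v i)) ∧
      ((Q.map fun i => τ.place (u i, v i)).map Prod.fst).Nodup ∧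
      ((Q.map fun i => τ.place (u i, v i)).map Prod.snd).Nodup := by
  have h : ∀ Q : List ℕ, Q.Pairwise (fun i j => u i < u j) → Q.Pairwise (fun i j => u i ≠ u j) :=
    fun Q h => h.imp fun h => h.ne
  have := h Q
  simp only [IsCapList, IsConvexCapOfType, isConvexPolygon_iff, List.triplewise_map, orient_place,
    List.nodup_iff_pairwise_ne, List.pairwise_map, turn]
  cases τ <;> simp only [CapType.Monotonic, CapType.place, List.pairwise_map, gt_iff_lt,
    neg_lt_neg_iff, ne_eq, neg_inj] at * <;> tauto

/-- The points with coordinates `u k` and `v k`, for `k < N`, are those of the grid with abscissas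
`U i` and ordinates `V j`, for `i j < n`, in decreasing order of their ordinates. -/
structure Enumerates (n N : ℕ) (U V u v : ℕ → ℝ) : Prop where
  mem : ∀ k < N, (∃ i < n, u k = U i) ∧ ∃ j < n, v k = V j
  exists_index : ∀ i < n, ∀ j < n, ∃ k < N, u k = U i ∧ v k = V j
  sort : ∀ k l, k < N → l < N → v l < v k → k < l

/-- The abscissas are strictly increasing and there are only `n` of them. -/
lemma Enumerates.length_le {n N : ℕ} {U V u v : ℕ → ℝ} (h : Enumerates n N U V u v) {Q : List ℕ}
    (hQ : IsCapList u v Q) (hN : ∀ q ∈ Q, q < N) : Q.length ≤ n := by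
  have hnd : (Q.map u).Nodup := by
    rw [List.nodup_iff_pairwise_ne, List.pairwise_map]
    exact hQ.1.imp fun h => h.ne
  have hsub : (Q.map u).toFinset ⊆ (Finset.range n).image U := by
    intro z hz
    simp only [List.mem_toFinset, List.mem_map] at hz
    obtain ⟨q, hq, rfl⟩ := hz
    obtain ⟨i, hi, e⟩ := (h.mem q (hN q hq)).1
    exact Finset.mem_image.2 ⟨i, Finset.mem_range.2 hi, e.symm⟩
  have := (Finset.card_le_card hsub).trans Finset.card_image_le
  rwa [List.toFinset_card_of_nodup hnd, List.length_map, Finset.card_range] at this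

/-! ### Sorting the points by rank -/

/-- The number of grid lines above the ordinate with index `j`. -/
noncomputable def rank (n : ℕ) (V : ℕ → ℝ) (j : ℕ) : ℕ :=
  ((Finset.range n).filter fun k => V j < V k).card

lemma rank_lt {n j : ℕ} {V : ℕ → ℝ} (hj : j < n) : rank n V j < n := by
  have : (Finset.range n).filter (fun k => V j < V k) ⊂ Finset.range n :=
    Finset.filter_ssubset.2 ⟨j, Finset.mem_range.2 hj, lt_irrefl _⟩
  simpa [rank] using Finset.card_lt_card this

lemma rank_lt_rank {n j k : ℕ} {V : ℕ → ℝ} (hk : k < n) (h : V j < V k) :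
    rank n V k < rank n V j := by
  refine Finset.card_lt_card (Finset.ssubset_iff_of_subset ?_ |>.2 ⟨k, ?_, ?_⟩)
  · exact Finset.monotone_filter_right _ fun l _ hl => h.trans hl
  · simp [hk, h]
  · simp

lemma rank_inj {n j k : ℕ} {V : ℕ → ℝ} (hV : Set.InjOn V (Set.Iio n)) (hj : j < n) (hk : k < n)
    (h : rank n V j = rank n V k) : j = k := by
  rcases lt_trichotomy (V j) (V k) with h' | h' | h'
  · exact absurd h (rank_lt_rank hk h').ne'
  · exact hV hj hk h'
  · exact absurd h (rank_lt_rank hj h').ne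

lemma exists_rank_eq {n r : ℕ} {V : ℕ → ℝ} (hV : Set.InjOn V (Set.Iio n)) (hr : r < n) :
    ∃ j < n, rank n V j = r := by
  have := Finset.surj_on_of_inj_on_of_card_le (s := Finset.range n) (t := Finset.range n)
    (fun j _ => rank n V j) (fun j hj => Finset.mem_range.2 (rank_lt (Finset.mem_range.1 hj)))
    (fun j k hj hk h => rank_inj hV (Finset.mem_range.1 hj) (Finset.mem_range.1 hk) h) le_rfl r
    (Finset.mem_range.2 hr)
  obtain ⟨j, hj, e⟩ := this
  exact ⟨j, Finset.mem_range.1 hj, e.symm⟩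

/-- Distinct ordinates have distinct ranks, so the ranks are a permutation of the numbers below `n`
and the blocks of `n` points on each grid line tile the array. Within a block the ordinates are
equal, so the order there is arbitrary. -/
lemma enumerates_of_rank {n : ℕ} {U V u v : ℕ → ℝ} (hV : Set.InjOn V (Set.Iio n))
    (h : ∀ j < n, ∀ i < n, u (rank n V j * n + i) = U i ∧ v (rank n V j * n + i) = V j) :
    Enumerates n (n * n) U V u v := by
  have key : ∀ k < n * n, ∃ j < n, ∃ i < n, k = rank n V j * n + i := by
    intro k hk
    have hn : 0 < n := Nat.pos_of_ne_zero fun h => by simp [h] at hk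
    obtain ⟨j, hj, e⟩ := exists_rank_eq hV (Nat.div_lt_of_lt_mul hk)
    exact ⟨j, hj, k % n, Nat.mod_lt _ hn, by rw [e, mul_comm, Nat.div_add_mod]⟩
  constructor
  · intro k hk
    obtain ⟨j, hj, i, hi, rfl⟩ := key k hk
    exact ⟨⟨i, hi, (h j hj i hi).1⟩, j, hj, (h j hj i hi).2⟩
  · exact fun i hi j hj => ⟨_, RealRAM.pair_lt hi (rank_lt hj), h j hj i hi⟩
  · intro k l hk hl hkl
    obtain ⟨j, hj, i, hi, rfl⟩ := key k hk
    obtain ⟨j', hj', i', hi', rfl⟩ := key l hl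
    rw [(h j hj i hi).2, (h j' hj' i' hi').2] at hkl
    exact RealRAM.pair_lt_pair _ hi (rank_lt_rank hj hkl)

/-! ### Programs that store the sorted points -/

namespace RealRAM

/-- The rotated abscissa with index in register `r`. -/
def abscissaE (τ : CapType) (r : ℕ) : RExpr :=
  match τ with
  | .top => .load 0 (.reg r)
  | .left => .load 1 (.reg r)
  | .bottom => .sub (.const 0) (.load 0 (.reg r))
  | .right => .sub (.const 0) (.load 1 (.reg r))

/-- The rotated ordinate with index in register `r`. -/
def ordinateE (τ : CapType) (r : ℕ) : RExpr :=
  match τ with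
  | .top => .load 1 (.reg r)
  | .left => .sub (.const 0) (.load 0 (.reg r))
  | .bottom => .sub (.const 0) (.load 1 (.reg r))
  | .right => .load 0 (.reg r)

lemma abscissaE_spec {S W r : ℕ} {σ : State} (τ : CapType) (hS : σ.ireg r < S)
    (hW : σ.ireg r ≤ W) : (abscissaE τ r).Ok S W σ ∧ (abscissaE τ r).cost ≤ 4 ∧
      (abscissaE τ r).val σ = τ.abscissa (σ.rmem 0) (σ.rmem 1) (σ.ireg r) := by
  cases τ <;> simp [abscissaE, RExpr.Ok, RExpr.cost, RExpr.val, CapType.abscissa, IExpr.Ok,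
    IExpr.val, IExpr.cost, hS, hW]

lemma ordinateE_spec {S W r : ℕ} {σ : State} (τ : CapType) (hS : σ.ireg r < S)
    (hW : σ.ireg r ≤ W) : (ordinateE τ r).Ok S W σ ∧ (ordinateE τ r).cost ≤ 4 ∧
      (ordinateE τ r).val σ = τ.ordinate (σ.rmem 0) (σ.rmem 1) (σ.ireg r) := by
  cases τ <;> simp [ordinateE, RExpr.Ok, RExpr.cost, RExpr.val, CapType.ordinate, IExpr.Ok,
    IExpr.val, IExpr.cost, hS, hW]

/-- Compute into register `4` the rank of the ordinate with index in register `3`. -/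
def computeRank (τ : CapType) : Program :=
  .seq (.setI 4 (.const 0)) (.forBelow 5 1 (.cond (.ltR (ordinateE τ 3) (ordinateE τ 5))
    (.setI 4 (.add (.reg 4) (.const 1))) .skip))

/-- Store the points on the grid line with index in register `3`. -/
def storeLine (τ : CapType) : Program :=
  .forBelow 5 1 (.seq (.storeR 4 (.add (.mul (.reg 4) (.reg 1)) (.reg 5)) (abscissaE τ 5))
    (.storeR 5 (.add (.mul (.reg 4) (.reg 1)) (.reg 5)) (ordinateE τ 3)))

/-- Store the points of the rotated grid in decreasing order of their ordinates. -/
def storePoints (τ : CapType) : Program :=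
  .forBelow 3 1 (.seq (computeRank τ) (storeLine τ))

/-- The states agree in the registers below `3` and in the real arrays below `4`. -/
def SameBase (σ ρ : State) : Prop :=
  (∀ r < 3, ρ.ireg r = σ.ireg r) ∧ ∀ a < 4, ρ.rmem a = σ.rmem a

lemma SameBase.trans {σ ρ π : State} (h : SameBase σ ρ) (h' : SameBase ρ π) : SameBase σ π :=
  ⟨fun r hr => (h'.1 r hr).trans (h.1 r hr), fun a ha => (h'.2 a ha).trans (h.2 a ha)⟩

lemma sameBase_update (σ : State) {r : ℕ} (hr : 3 ≤ r) (z : ℕ) :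
    SameBase σ { σ with ireg := Function.update σ.ireg r z } :=
  ⟨fun s hs => Function.update_of_ne (by omega) _ _, fun _ _ => rfl⟩

section
variable {S W n j : ℕ} {σ : State} {τ : CapType} {U V : ℕ → ℝ}

lemma computeRank_spec (hn : 1 ≤ n) (hS : n ≤ S) (hW : n + 1 ≤ W) (h1 : σ.ireg 1 = n)
    (h3 : σ.ireg 3 = j) (hj : j < n) (hV : τ.ordinate (σ.rmem 0) (σ.rmem 1) = V) :
    wp S W (computeRank τ) (fun ρ t => t ≤ 400 * n ∧ SameBase σ ρ ∧ ρ.ireg 3 = j ∧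
      ρ.rmem = σ.rmem ∧ ρ.ireg 4 = rank n V j) σ := by
  rw [computeRank, wp_seq, wp_setI]
  refine ⟨by simp [IExpr.Ok], ?_⟩
  have hu := sameBase_update σ (r := 4) (by norm_num) (IExpr.val σ (.const 0))
  refine (wp_forBelow (I := fun k ρ => SameBase σ ρ ∧ ρ.ireg 3 = j ∧ ρ.rmem = σ.rmem ∧
    ρ.ireg 4 = rank k V j) (M := n) (T := 25) (by norm_num) hn hW ?_ (by norm_num) ?_ ?_).mono ?_
  · simpa using h1
  · refine ⟨hu.trans (sameBase_update _ (by norm_num) _), ?_, ?_, ?_⟩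
    · simpa using h3
    · rfl
    · simp [rank, IExpr.val]
  · rintro k hk ρ r5 r1 ⟨hb, r3, hm, r4⟩
    have hle : rank k V j ≤ k := by
      simpa [rank] using Finset.card_filter_le (Finset.range k) fun l => V j < V l
    obtain ⟨a₁, a₂, a₃⟩ := ordinateE_spec (S := S) (W := W) (σ := ρ) (r := 3) τ (by omega)
      (by omega)
    obtain ⟨b₁, b₂, b₃⟩ := ordinateE_spec (S := S) (W := W) (σ := ρ) (r := 5) τ (by omega)
      (by omega)
    rw [hm, hV] at a₃ b₃
    -- The loop counts over the first `k` ordinates, so its partial count is the rank with `n`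
    -- replaced by `k`.
    have hsucc : rank (k + 1) V j = rank k V j + if V j < V k then 1 else 0 := by
      simp only [rank, Finset.range_add_one, Finset.filter_insert]
      split_ifs <;> simp
    rw [wp_cond]
    refine ⟨⟨a₁, b₁⟩, fun hh => ?_, fun hh => ?_⟩
    · simp only [Test.Holds, a₃, b₃, r3, r5] at hh
      rw [wp_setI]
      refine ⟨by simp [IExpr.Ok, IExpr.val, r4]; omega, ?_, ?_, ?_,
        (hb.trans (sameBase_update _ (by norm_num) _)).trans (sameBase_update _ (by norm_num) _),
        ?_, ?_, ?_⟩
      · simp only [Test.cost, IExpr.cost]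
        omega
      · simpa using r5
      · simpa using r1
      · simpa using r3
      · exact hm
      · simp [IExpr.val, r4, hsucc, hh]
    · simp only [Test.Holds, a₃, b₃, r3, r5] at hh
      rw [wp_skip]
      refine ⟨?_, r5, r1, hb.trans (sameBase_update _ (by norm_num) _), ?_, hm, ?_⟩
      · simp only [Test.cost]
        omega
      · simpa using r3
      · simp [r4, hsucc, hh]
  · rintro ρ t ⟨ht, -, -, hb, r3, hm, r4⟩
    refine ⟨?_, hb, r3, hm, r4⟩
    simp only [IExpr.cost]
    omega

/-- The last clause, that cells outside the block are untouched, protects the lines stored earlier.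
-/
lemma storeLine_spec {q : ℕ} (hn : 1 ≤ n) (hS : n * n ≤ S) (hW : n * n + 1 ≤ W)
    (h1 : σ.ireg 1 = n) (h3 : σ.ireg 3 = j) (hj : j < n) (h4 : σ.ireg 4 = q) (hq : q < n)
    (hU : τ.abscissa (σ.rmem 0) (σ.rmem 1) = U) (hV : τ.ordinate (σ.rmem 0) (σ.rmem 1) = V) :
    wp S W (storeLine τ) (fun ρ t => t ≤ 400 * n ∧ SameBase σ ρ ∧ ρ.ireg 3 = j ∧
      (∀ i < n, ρ.rmem 4 (q * n + i) = U i ∧ ρ.rmem 5 (q * n + i) = V j) ∧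
      ∀ k, (∀ i < n, k ≠ q * n + i) → ρ.rmem 4 k = σ.rmem 4 k ∧ ρ.rmem 5 k = σ.rmem 5 k) σ := by
  have hnn : n ≤ n * n := Nat.le_mul_self n
  refine (wp_forBelow (I := fun i ρ => SameBase σ ρ ∧ ρ.ireg 3 = j ∧ ρ.ireg 4 = q ∧
      (∀ i' < i, ρ.rmem 4 (q * n + i') = U i' ∧ ρ.rmem 5 (q * n + i') = V j) ∧
      ∀ k, (∀ i < n, k ≠ q * n + i) → ρ.rmem 4 k = σ.rmem 4 k ∧ ρ.rmem 5 k = σ.rmem 5 k)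
    (M := n) (T := 25) (by norm_num) hn (by omega) h1 (by norm_num) ?_ ?_).mono ?_
  · refine ⟨sameBase_update _ (by norm_num) _, ?_, ?_, ?_, ?_⟩
    · simpa using h3
    · simpa using h4
    · exact fun _ h => absurd h (Nat.not_lt_zero _)
    · exact fun _ _ => ⟨rfl, rfl⟩
  · rintro i hi ρ r5 r1 ⟨hb, r3, r4, hw, hk⟩
    have hlt := pair_lt hi hq
    obtain ⟨a₁, a₂, a₃⟩ := abscissaE_spec (S := S) (W := W) (σ := ρ) (r := 5) τ (by omega)
      (by omega)
    rw [hb.2 0 (by norm_num), hb.2 1 (by norm_num), hU, r5] at a₃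
    rw [wp_seq, wp_storeR]
    refine ⟨by simp [IExpr.Ok, IExpr.val, r4, r1, r5]; omega,
      by simp [IExpr.val, r4, r1, r5]; omega, a₁, ?_⟩
    simp only [IExpr.val, r4, r1, r5, a₃]
    obtain ⟨ρ₁, hρ₁⟩ : ∃ ρ₁ : State, ρ₁ = { ρ with
      rmem := Function.update ρ.rmem 4 (Function.update (ρ.rmem 4) (q * n + i) (U i)) } := ⟨_, rfl⟩
    rw [← hρ₁]
    have s : ρ₁.ireg = ρ.ireg := by rw [hρ₁]
    have m : ∀ a, a ≠ 4 → ρ₁.rmem a = ρ.rmem a := by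
      intro a ha
      rw [hρ₁]
      exact Function.update_of_ne ha _ _
    have m4 : ρ₁.rmem 4 = Function.update (ρ.rmem 4) (q * n + i) (U i) := by simp [hρ₁]
    clear hρ₁
    obtain ⟨b₁, b₂, b₃⟩ := ordinateE_spec (S := S) (W := W) (σ := ρ₁) (r := 3) τ
      (by rw [s]; omega) (by rw [s]; omega)
    rw [m 0 (by norm_num), m 1 (by norm_num), s, hb.2 0 (by norm_num), hb.2 1 (by norm_num), hV,
      r3] at b₃
    rw [wp_storeR]
    refine ⟨by simp [IExpr.Ok, IExpr.val, s, r4, r1, r5]; omega,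
      by simp [IExpr.val, s, r4, r1, r5]; omega, b₁, ?_⟩
    simp only [IExpr.val, s, r4, r1, r5, b₃]
    refine ⟨?_, by simp, by simp, ⟨fun r hr => ?_, fun a ha => ?_⟩,
      ?_, ?_, fun i' hi' => ?_, fun k hk' => ?_⟩
    · simp only [IExpr.cost]
      omega
    · rw [← hb.1 r hr]
      exact Function.update_of_ne (by omega) _ _
    · rw [← hb.2 a ha, ← m a (by omega)]
      exact Function.update_of_ne (by omega) _ _
    · simpa [s] using r3
    · simpa [s] using r4
    · rcases Nat.lt_succ_iff_lt_or_eq.1 hi' with hi' | rfl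
      · have hne : q * n + i' ≠ q * n + i := by omega
        simpa [m4, m 5, hi'.ne] using hw i' hi'
      · simp [m4]
    · have hne := hk' i hi
      simpa [m4, m 5, hne] using hk k hk'
  · rintro ρ t ⟨ht, -, -, hb, r3, r4, hw, hk⟩
    exact ⟨by omega, hb, r3, hw, hk⟩

lemma storePoints_spec (hn : 1 ≤ n) (hS : n * n ≤ S) (hW : n * n + 1 ≤ W)
    (h1 : σ.ireg 1 = n)
    (hU : τ.abscissa (σ.rmem 0) (σ.rmem 1) = U) (hV : τ.ordinate (σ.rmem 0) (σ.rmem 1) = V)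
    (hinj : Set.InjOn V (Set.Iio n)) :
    wp S W (storePoints τ) (fun ρ t => t ≤ 12000 * (n * n) ∧ SameBase σ ρ ∧
      Enumerates n (n * n) U V (ρ.rmem 4) (ρ.rmem 5)) σ := by
  have hnn : n ≤ n * n := Nat.le_mul_self n
  refine (wp_forBelow (I := fun j ρ => SameBase σ ρ ∧ ∀ j' < j, ∀ i < n,
      ρ.rmem 4 (rank n V j' * n + i) = U i ∧ ρ.rmem 5 (rank n V j' * n + i) = V j')
    (M := n) (T := 800 * n) (by norm_num) hn (by omega) h1 (by omega) ?_ ?_).mono ?_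
  · exact ⟨sameBase_update _ (by norm_num) _, fun _ h => absurd h (Nat.not_lt_zero _)⟩
  · rintro j hj ρ r3 r1 ⟨hb, hw⟩
    have e0 := hb.2 0 (by norm_num)
    have e1 := hb.2 1 (by norm_num)
    rw [wp_seq]
    refine (computeRank_spec (V := V) hn (by omega) (by omega) r1 r3 hj
      (by rw [e0, e1, hV])).mono ?_
    rintro ρ₁ t₁ ⟨ht₁, hb₁, q3, hm₁, q4⟩
    refine (storeLine_spec (U := U) (V := V) hn hS hW ((hb₁.1 1 (by norm_num)).trans r1) q3 hj q4
      (rank_lt hj) (by rw [hm₁, e0, e1, hU]) (by rw [hm₁, e0, e1, hV])).mono ?_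
    rintro ρ₂ t₂ ⟨ht₂, hb₂, p3, hw₂, hk₂⟩
    have hb' := hb₁.trans hb₂
    refine ⟨by omega, p3, (hb'.1 1 (by norm_num)).trans r1,
      (hb.trans hb').trans (sameBase_update _ (by norm_num) _), fun j' hj' i hi => ?_⟩
    rcases Nat.lt_succ_iff_lt_or_eq.1 hj' with hj' | rfl
    -- Different lines have different ranks, hence disjoint blocks.
    · have := hk₂ (rank n V j' * n + i) fun i' hi' h =>
        hj'.ne (rank_inj hinj (hj'.trans hj) hj (pair_inj hi hi' h).1)
      show ρ₂.rmem 4 _ = _ ∧ ρ₂.rmem 5 _ = _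
      rw [this.1, this.2, hm₁]
      exact hw j' hj' i hi
    · exact hw₂ i hi
  · rintro ρ t ⟨ht, -, -, hb, hw⟩
    refine ⟨ht.trans (le_of_eq (by ring)), hb, enumerates_of_rank hinj hw⟩

end

end RealRAM

/-! ### Supported caps and reachable index lists -/

/-- Being a convex cap of one of the given types. -/
def IsCapOfTypes (l : List CapType) (P : List (ℝ × ℝ)) : Prop :=
  ∃ τ ∈ l, IsConvexCapOfType τ P

/-- The grid with coordinate sequences `x` and `y`, each of length `n`, supports `P`. -/
def SupportsSeq (n : ℕ) (x y : ℕ → ℝ) (P : List (ℝ × ℝ)) : Prop :=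
  Supports (x '' Set.Iio n) (y '' Set.Iio n) P

lemma place_mem {τ : CapType} {n i j : ℕ} {x y : ℕ → ℝ} (hi : i < n) (hj : j < n) :
    τ.place (τ.abscissa x y i, τ.ordinate x y j) ∈ (x '' Set.Iio n) ×ˢ (y '' Set.Iio n) := by
  cases τ <;> simp only [CapType.place, CapType.abscissa, CapType.ordinate, Pi.neg_apply, neg_neg]
    <;> first
      | exact ⟨⟨i, hi, rfl⟩, ⟨j, hj, rfl⟩⟩
      | exact ⟨⟨j, hj, rfl⟩, ⟨i, hi, rfl⟩⟩

lemma exists_place_eq (τ : CapType) {n : ℕ} {x y : ℕ → ℝ} {p : ℝ × ℝ}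
    (hp : p ∈ (x '' Set.Iio n) ×ˢ (y '' Set.Iio n)) :
    ∃ i < n, ∃ j < n, τ.place (τ.abscissa x y i, τ.ordinate x y j) = p := by
  obtain ⟨⟨i, hi, hx⟩, j, hj, hy⟩ := hp
  obtain ⟨a, b⟩ := p
  simp only at hx hy
  subst hx hy
  cases τ <;> simp only [CapType.place, CapType.abscissa, CapType.ordinate, Pi.neg_apply, neg_neg]
    <;> first
      | exact ⟨i, hi, j, hj, rfl⟩
      | exact ⟨j, hj, i, hi, rfl⟩

section
variable {n N : ℕ} {x y u v : ℕ → ℝ} {τ : CapType}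

lemma Reach.supports (h : Enumerates n N (τ.abscissa x y) (τ.ordinate x y) u v) {a b c d : ℕ}
    {Q : List ℕ} (hQ : Reach u v N a b c d Q) :
    SupportsSeq n x y (Q.map fun i => τ.place (u i, v i)) ∧
      IsConvexCapOfType τ (Q.map fun i => τ.place (u i, v i)) := by
  obtain ⟨hc, -, -, -, hN⟩ := hQ.invariant
  obtain ⟨hcap, h₁, h₂⟩ := (isCapList_iff τ).1 hc
  refine ⟨⟨fun p hp => ?_, h₁, h₂⟩, hcap⟩
  obtain ⟨q, hq, rfl⟩ := List.mem_map.1 hp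
  obtain ⟨⟨i, hi, ei⟩, j, hj, ej⟩ := h.mem q (hN q hq)
  rw [ei, ej]
  exact place_mem hi hj

/-- Each vertex is the rotation of some enumerated point. Choosing an index for each vertex yields
an index list whose image is `P` itself. -/
lemma exists_reach_of_supports (h : Enumerates n N (τ.abscissa x y) (τ.ordinate x y) u v)
    {P : List (ℝ × ℝ)} (hP : SupportsSeq n x y P) (hcap : IsConvexCapOfType τ P) (hne : P ≠ []) :
    ∃ a b c d Q, Reach u v N a b c d Q ∧ Q.length = P.length := by
  have hex : ∀ p ∈ P, ∃ k < N, τ.place (u k, v k) = p := by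
    intro p hp
    obtain ⟨i, hi, j, hj, e⟩ := exists_place_eq τ (hP.1 p hp)
    obtain ⟨k, hk, ek⟩ := h.exists_index i hi j hj
    exact ⟨k, hk, by rw [ek.1, ek.2, e]⟩
  choose! g hgN hg using hex
  have hmap : ((P.map g).map fun i => τ.place (u i, v i)) = P := by
    rw [List.map_map]
    exact (List.map_congr_left hg).trans (List.map_id P)
  have hc : IsCapList u v (P.map g) := by
    rw [isCapList_iff τ, hmap]
    exact ⟨hcap, hP.2⟩
  obtain ⟨a, b, c, d, hr⟩ := hc.exists_reach (N := N)
    (fun q hq => by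
      obtain ⟨p, hp, rfl⟩ := List.mem_map.1 hq
      exact hgN p hp) (by simpa using hne)
  exact ⟨a, b, c, d, _, hr, by simp⟩

end

/-! ### The complete algorithm -/

namespace RealRAM

/-- Replace the output by a maximum-size supported cap of type `τ` if that is larger. -/
def improve (τ : CapType) : Program := .seq (storePoints τ) (fillTable τ)

/-- Replace the output by a maximum-size supported cap of one of the given types if that is
larger. -/
def improveAll : List CapType → Program
  | [] => .skip
  | τ :: l => .seq (improve τ) (improveAll l)

/-- Compute a maximum-size supported cap of one of the given types. -/
def maxCap (l : List CapType) : Program :=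
  .seq (.setI 1 (.reg 0)) (.seq (.setI 2 (.mul (.reg 1) (.reg 1)))
    (.seq (.setI 0 (.const 0)) (improveAll l)))

/-- The grid is in memory, and the output is a supported polygon with property `K`. -/
structure Ready (K : List (ℝ × ℝ) → Prop) (n : ℕ) (x y : ℕ → ℝ) (σ : State) : Prop where
  reg1 : σ.ireg 1 = n
  reg2 : σ.ireg 2 = n * n
  mem0 : σ.rmem 0 = x
  mem1 : σ.rmem 1 = y
  supports : SupportsSeq n x y (output σ)
  prop : K (output σ)
  length_le : σ.ireg 0 ≤ n

section
variable {S W n : ℕ} {x y : ℕ → ℝ} {K : List (ℝ × ℝ) → Prop} {σ : State}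

/-- The table bounds every reachable cap and the output is at least as long as every entry.
Conversely, the output is always a supported polygon with property `K`, either inherited or read off
from the table. -/
lemma improve_spec {τ : CapType} (hn : 1 ≤ n) (hS : (n * n) ^ 4 ≤ S)
    (hW : (n * n) ^ 4 + n + 1 ≤ W) (hx : Set.InjOn x (Set.Iio n)) (hy : Set.InjOn y (Set.Iio n))
    (hK : ∀ P, IsConvexCapOfType τ P → K P) (hσ : Ready K n x y σ) :
    wp S W (improve τ) (fun ρ t => t ≤ 1000000000 * (n * n) ^ 5 ∧ Ready K n x y ρ ∧
      σ.ireg 0 ≤ ρ.ireg 0 ∧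
      ∀ P, SupportsSeq n x y P → IsConvexCapOfType τ P → P.length ≤ ρ.ireg 0) σ := by
  have hN1 : 1 ≤ n * n := Nat.le_mul_of_pos_left n hn |>.trans' hn
  have hN4 : n * n ≤ (n * n) ^ 4 := Nat.le_self_pow (by norm_num) _
  have hN5 : n * n ≤ (n * n) ^ 5 := Nat.le_self_pow (by norm_num) _
  have hinj : Set.InjOn (τ.ordinate x y) (Set.Iio n) := by
    cases τ
    · exact hy
    · exact fun i hi j hj h => hx hi hj (neg_injective h)
    · exact fun i hi j hj h => hy hi hj (neg_injective h)
    · exact hx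
  rw [improve, wp_seq]
  refine (storePoints_spec (τ := τ) (U := τ.abscissa x y) (V := τ.ordinate x y) hn (by omega)
    (by omega) hσ.reg1 (by rw [hσ.mem0, hσ.mem1]) (by rw [hσ.mem0, hσ.mem1]) hinj).mono ?_
  rintro σ₁ t ⟨ht, hb, hE⟩
  have hs : Setting S W n (n * n) (σ₁.rmem 4) (σ₁.rmem 5) :=
    ⟨hN1, Nat.le_mul_self n, hS, hW, hE.sort, fun a b c d Q hQ =>
      hE.length_le hQ.invariant.1 hQ.invariant.2.2.2.2⟩
  have h0 := hb.1 0 (by norm_num)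
  refine (fillTable_spec (τ := τ) (x := x) (y := y)
    (G := fun P => SupportsSeq n x y P ∧ K P) (L := σ.ireg 0) hs
    (fun a b c d Q hQ => ⟨(hQ.supports hE).1, hK _ (hQ.supports hE).2⟩)
    ((hb.1 1 (by norm_num)).trans hσ.reg1) ((hb.1 2 (by norm_num)).trans hσ.reg2)
    ((hb.2 0 (by norm_num)).trans hσ.mem0) ((hb.2 1 (by norm_num)).trans hσ.mem1) rfl rfl
    (good_of_output_congr (G := fun P => SupportsSeq n x y P ∧ K P) ⟨hσ.supports, hσ.prop⟩ h0
      (hb.2 2 (by norm_num)) (hb.2 3 (by norm_num))) h0 hσ.length_le).mono ?_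
  rintro ρ t' ⟨ht', hI⟩
  refine ⟨by omega, ⟨hI.reg1, hI.reg2, hI.mem0, hI.mem1, hI.good.1, hI.good.2, hI.length_le⟩,
    hI.le_length, fun P hP hcap => ?_⟩
  rcases eq_or_ne P [] with rfl | hne
  · simp
  obtain ⟨a, b, c, d, Q, hQ, hlen⟩ := exists_reach_of_supports hE hP hcap hne
  obtain ⟨ha, hb', hc, hd⟩ := hQ.lt
  have hlt := (code_bound ha hb' hc hd).2.2.2.2.2
  rw [← hlen]
  exact ((hI.table a b c d ha hb' hc hd hlt).1 Q hQ).trans (hI.max _ hlt)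

lemma improveAll_spec (l : List CapType) (hn : 1 ≤ n) (hS : (n * n) ^ 4 ≤ S)
    (hW : (n * n) ^ 4 + n + 1 ≤ W) (hx : Set.InjOn x (Set.Iio n)) (hy : Set.InjOn y (Set.Iio n))
    (hK : ∀ τ ∈ l, ∀ P, IsConvexCapOfType τ P → K P) (hσ : Ready K n x y σ) :
    wp S W (improveAll l) (fun ρ t => t ≤ 1000000000 * (n * n) ^ 5 * l.length + 1 ∧
      Ready K n x y ρ ∧ σ.ireg 0 ≤ ρ.ireg 0 ∧
      ∀ P, SupportsSeq n x y P → IsCapOfTypes l P → P.length ≤ ρ.ireg 0) σ := by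
  induction l generalizing σ with
  | nil =>
    rw [improveAll, wp_skip]
    refine ⟨by simp, hσ, le_rfl, ?_⟩
    rintro P - ⟨τ, hτ, -⟩
    simp at hτ
  | cons τ l ih =>
    rw [improveAll, wp_seq]
    refine (improve_spec hn hS hW hx hy (hK τ (by simp)) hσ).mono ?_
    rintro σ₁ t ⟨ht, h₁, hle, hmax⟩
    refine (ih (fun τ' hτ' => hK τ' (List.mem_cons_of_mem _ hτ')) h₁).mono ?_
    rintro ρ t' ⟨ht', h₂, hle', hmax'⟩
    refine ⟨?_, h₂, hle.trans hle', ?_⟩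
    · rw [List.length_cons, mul_add]
      omega
    · rintro P hP ⟨τ', hτ', hcap⟩
      rcases List.mem_cons.1 hτ' with rfl | hτ'
      · exact (hmax P hP hcap).trans hle'
      · exact hmax' P hP ⟨τ', hτ', hcap⟩

end

end RealRAM

open RealRAM in
-- One pass per type, each keeping the best output so far. `l ≠ []` makes the empty list a
-- legitimate initial output.
theorem maxSupportedComputable_of_types {l : List CapType} (hl : l ≠ []) :
    MaxSupportedComputable (IsCapOfTypes l) (fun n => n ^ 10) (fun n => n ^ 8) := by
  -- Each type costs at most `1000000000 * n ^ 10`. The extra 20 pays for the initialization and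
  -- gives room for `n ^ 8 + n + 1` in the word bound, whose exponent 8 is that of the table size.
  refine ⟨maxCap l, 1000000000 * l.length + 20, 8, fun n hn x y hx hy => ?_⟩
  set C := 1000000000 * l.length + 20 with hC
  have h8 : (n * n) ^ 4 = n ^ 8 := by ring
  have h10 : (n * n) ^ 5 = n ^ 10 := by ring
  have hn8 : n * n ≤ n ^ 8 := h8 ▸ Nat.le_self_pow (by norm_num) _
  have hn10 : 1 ≤ n ^ 10 := Nat.one_le_pow _ _ hn
  have hnn : n ≤ n * n := Nat.le_mul_self n
  have hC8 : 20 * n ^ 8 ≤ C * n ^ 8 := Nat.mul_le_mul_right _ (by omega)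
  have hval : ∀ (z : Fin n → ℝ) (i : ℕ) (hi : i < n),
      (fun i => if h : i < n then z ⟨i, h⟩ else 0) i = z ⟨i, hi⟩ := fun z i hi => dif_pos hi
  have hrange : ∀ z : Fin n → ℝ,
      (fun i => if h : i < n then z ⟨i, h⟩ else 0) '' Set.Iio n = Set.range z := by
    intro z
    ext w
    constructor
    · rintro ⟨i, hi, rfl⟩
      exact ⟨⟨i, hi⟩, (hval z i hi).symm⟩
    · rintro ⟨i, rfl⟩
      exact ⟨i, i.2, hval z i i.2⟩
  have hinj : ∀ z : Fin n → ℝ, Function.Injective z →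
      Set.InjOn (fun i => if h : i < n then z ⟨i, h⟩ else 0) (Set.Iio n) := by
    intro z hz i hi j hj h
    rw [hval z i hi, hval z j hj] at h
    exact congrArg Fin.val (hz h)
  have hsup : ∀ P, SupportsSeq n (fun i => if h : i < n then x ⟨i, h⟩ else 0)
      (fun i => if h : i < n then y ⟨i, h⟩ else 0) P ↔ Supports (Set.range x) (Set.range y) P := by
    intro P
    rw [SupportsSeq, hrange, hrange]
  have hnil : IsCapOfTypes l [] := by
    obtain ⟨τ, hτ⟩ := List.exists_mem_of_ne_nil l hl
    exact ⟨τ, hτ, fun i => i.elim0, by cases τ <;> exact List.Pairwise.nil⟩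
  have key : wp (C * n ^ 8) (C * n ^ 8) (maxCap l) (fun σ t => t ≤ C * n ^ 10 ∧
      IsMaxSupported (IsCapOfTypes l) (Set.range x) (Set.range y) (output σ)) (input n x y) := by
    rw [maxCap, wp_seq, wp_setI]
    refine ⟨by simp [IExpr.Ok, input]; omega, ?_⟩
    rw [wp_seq, wp_setI]
    refine ⟨by simp [IExpr.Ok, IExpr.val, input]; omega, ?_⟩
    rw [wp_seq, wp_setI]
    refine ⟨by simp [IExpr.Ok], ?_⟩
    refine (improveAll_spec (K := IsCapOfTypes l) l hn (by omega) (by omega) (hinj x hx)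
      (hinj y hy) (fun τ hτ P hP => ⟨τ, hτ, hP⟩) ?_).mono ?_
    · constructor
      · simp [IExpr.val, input]
      · simp [IExpr.val, input]
      · simp [input]
      · simp [input]
      · simp [output, IExpr.val, SupportsSeq, Supports]
      · simpa [output, IExpr.val] using hnil
      · simp [IExpr.val]
    · rintro σ t ⟨ht, hr, -, hmax⟩
      refine ⟨?_, (hsup _).1 hr.supports, hr.prop, fun Q hQ hcap => ?_⟩
      · rw [h10, mul_right_comm] at ht
        rw [hC, add_mul]
        simp only [IExpr.cost]
        omega
      · simpa [output] using hmax Q ((hsup Q).2 hQ) hcap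
  obtain ⟨σ, t, he, ht, hmax⟩ := key
  exact ⟨σ, t, he, ht, hmax⟩

theorem mainTheorem9 :
    MaxSupportedComputable IsConvexCap (fun n => n ^ 10) (fun n => n ^ 8) ∧
    ∀ τ : CapType,
      MaxSupportedComputable (IsConvexCapOfType τ) (fun n => n ^ 10) (fun n => n ^ 8) := by
  constructor
  · have h : IsConvexCap = IsCapOfTypes [.top, .left, .bottom, .right] := by
      funext P
      refine propext ⟨fun ⟨τ, h⟩ => ⟨τ, by cases τ <;> simp, h⟩, fun ⟨τ, _, h⟩ => ⟨τ, h⟩⟩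
    rw [h]
    exact maxSupportedComputable_of_types (by simp)
  · intro τ
    have h : IsConvexCapOfType τ = IsCapOfTypes [τ] := by
      funext P
      simp [IsCapOfTypes]
    rw [h]
    exact maxSupportedComputable_of_types (by simp)
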